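/- Let $k\in\mathbb N$ and let $N=M^Q\cup_\Sigma M^P$ with $M^P=k\cdot R=\{1,\dots,k\}\times R$ and $\Sigma=k\cdot\Sigma_R=\{1,\dots,k\}\times\Sigma_R$, $\Sigma_R\subseteq R$. That is, $N$ is a locally compact Hausdorff space (for instance a smooth manifold, possibly with boundary or corners, possibly non-compact), $M^Q$ and $M^P$ are closed subspaces of $N$ with $M^Q\cup M^P=N$, and $M^Q\cap M^P=\Sigma$ (for instance, $M^Q$ and $M^P$ are manifolds with boundary glued along a manifold $\Sigma$ that lies in the boundary of each). For $p\in R$ write $p_i=(i,p)\in M^P$, $1\le i\le k$, for the points over $p$; for $p\in\Sigma_R$ these points lie in $\Sigma\subseteq M^Q$. Let $\sim$ be the equivalence relation on $N$ in which each point of $M^Q$ is equivalent only to itself, and two points of $M^P-\Sigma$ are equivalent if and only if they have the same image in $R$. Let $\mathcal G=\{(x,y):x\sim y\}\subseteq N\times N$, with the subspace topology, be the associated étale groupoid, and let $C^*(\mathcal G)$ be its (full) groupoid $C^*$-algebra: the completion of the convolution $*$-algebra $C_c(\mathcal G)$, with $(h*h')(x,z)=\sum_{y\sim x}h(x,y)h'(y,z)$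 and $h^*(x,y)=\overline{h(y,x)}$, in the norm $\sup_\rho\|\rho(h)\|$ over all $*$-representations $\rho$ on Hilbert spaces that are bounded for the $I$-norm. Let $M_k$ be the algebra of complex $k\times k$ matrices, and put $$A=\bigl\{(f,g)\in C_0(M^Q)\oplus C_0(R,M_k)\;:\; g(p)=\operatorname{diag}\bigl(f(p_1),\dots,f(p_k)\bigr)\ \text{for all } p\in\Sigma_R\bigr\},$$ i.e. $g|_{\Sigma_R}$ is diagonal and $\alpha(f|_\Sigma)=g|_{\Sigma_R}$ for the diagonal inclusion $\alpha:C_0(\Sigma)\cong\bigoplus_{i=1}^kC_0(\Sigma_R)\to M_k(C_0(\Sigma_R))$. Then there is a $*$-isomorphism $\Phi:C^*(\mathcal G)\to A$ such that for $h\in C_c(\mathcal G)$ one has $\Phi(h)=(f_h,g_h)$ with $f_h(q)=h(q,q)$ for $q\in M^Q$ and $g_h(p)=[h(p_i,p_j)]_{i,j}$ for $p\in R$, where $h$ is extended by $0$ to $N\times N$ (so that $g_h(p)=\operatorname{diag}(h(p_1,p_1),\dots,h(p_k,p_k))$ for $p\in\Sigma_R$). Consequently there is a short exact sequence of $C^*$-algebras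 $$0\to C_0(R-\Sigma_R)\otimes M_k\xrightarrow{\ \iota\ }C^*(\mathcal G)\xrightarrow{\ \rho\ }C_0(M^Q)\to0,$$ in which $\rho(a)$ is the first component of $\Phi(a)$, and the second component of $\Phi(\iota(f\otimes T))$ is the function $f\cdot T$ on $R-\Sigma_R$ extended by $0$ to $R$. -/

import Mathlib

open Set Filter Topology
open scoped TensorProduct ZeroAtInfty CompactlySupported ComplexOrder ENNReal

universe u v w

/-! ## Étale equivalence relations and their groupoid C*-algebras -/

/-- The groupoid of an equivalence relation on `X`: its graph, a subspace of `X × X`.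
The unit space is the diagonal, the range and source maps are the two coordinates, and
`(x, y)(y, z) = (x, z)`, `(x, y)⁻¹ = (y, x)`. -/
abbrev RelGroupoid {X : Type u} (r : Setoid X) : Type u := {γ : X × X // r γ.1 γ.2}

/-- The groupoid of `r` is étale: its range map is a local homeomorphism
(hence so is its source map). -/
class IsEtaleRel {X : Type u} [TopologicalSpace X] (r : Setoid X) : Prop where
  isLocalHomeomorph_range : IsLocalHomeomorph (fun γ : RelGroupoid r => γ.1.1)

/-- The space `C_c(𝒢)` of compactly supported continuous functions on the groupoid of `r`.
It is given below the convolution product and the involution `f*(x, y) = conj f(y, x)`,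
not the pointwise ones. -/
def ConvAlg {X : Type u} [TopologicalSpace X] (r : Setoid X) : Type u := C_c(RelGroupoid r, ℂ)

section FiberSum

variable {E : Type u} {B : Type v} [TopologicalSpace E] [TopologicalSpace B]

/-- A continuous, open, locally injective map is a local homeomorphism. -/
theorem isLocalHomeomorph_of_open_of_locInj {p : E → B} (hc : Continuous p) (ho : IsOpenMap p)
    (hi : ∀ e, ∃ U : Set E, IsOpen U ∧ e ∈ U ∧ Set.InjOn p U) : IsLocalHomeomorph p := by
  rw [isLocalHomeomorph_iff_isOpenEmbedding_restrict]
  intro e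
  obtain ⟨U, hU, heU, hinj⟩ := hi e
  refine ⟨U, hU.mem_nhds heU, ?_⟩
  rw [isOpenEmbedding_iff_continuous_injective_isOpenMap]
  exact ⟨hc.comp continuous_subtype_val, Set.injOn_iff_injective.mp hinj,
    ho.comp hU.isOpenMap_subtype_val⟩

theorem fiber_inter_compact_finite {p : E → B} [T2Space B] (hp : IsLocalHomeomorph p)
    {K : Set E} (hK : IsCompact K) (b : B) : (K ∩ p ⁻¹' {b}).Finite := by
  have hKb : IsCompact (K ∩ p ⁻¹' {b}) :=
    hK.inter_right (isClosed_singleton.preimage hp.continuous)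
  refine hKb.finite (isDiscrete_iff_forall_mem_exists_isOpen.mpr ?_)
  intro e he
  obtain ⟨φ, heφ, hφ⟩ := hp e
  refine ⟨φ.source, φ.open_source, ?_⟩
  ext e'
  constructor
  · rintro ⟨h1, h2, h3⟩
    have h4 : p e' = p e := by
      have := he.2
      simp only [mem_preimage, mem_singleton_iff] at h3 this
      rw [h3, this]
    exact φ.injOn h1 heφ (by rw [← hφ]; exact h4)
  · rintro rfl
    exact ⟨heφ, he⟩

/-- Summation over the fibres of a local homeomorphism maps compactly supported continuous
functions to continuous functions. -/
theorem continuous_fiberSum [T2Space E] [T2Space B] {p : E → B} (hp : IsLocalHomeomorph p)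
    {F : E → ℂ} (hF : Continuous F) {K : Set E} (hK : IsCompact K) (hFK : ∀ e, F e ≠ 0 → e ∈ K) :
    Continuous (fun b => ∑ᶠ e ∈ p ⁻¹' {b}, F e) := by
  classical
  rw [continuous_iff_continuousAt]
  intro b₀
  have hfin := fiber_inter_compact_finite hp hK b₀
  obtain ⟨U, hU, hdisj⟩ := hfin.t2_separation
  choose φ hφmem hφ using fun e => hp e
  let ψ : E → OpenPartialHomeomorph E B := fun e => (φ e).restrOpen (U e) (hU e).2
  have hψmem : ∀ e, e ∈ (ψ e).source := fun e => by
    simp only [ψ, OpenPartialHomeomorph.restrOpen_source]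
    exact ⟨hφmem e, (hU e).1⟩
  have hψU : ∀ e, (ψ e).source ⊆ U e := fun e => by
    simp only [ψ, OpenPartialHomeomorph.restrOpen_source]
    exact inter_subset_right
  have hψ : ∀ e, ∀ x, ψ e x = p x := fun e x => by
    have : ψ e x = φ e x := rfl
    rw [this, ← hφ e]
  set S : Finset E := hfin.toFinset with hS
  have hSmem : ∀ e, e ∈ S ↔ e ∈ K ∧ p e = b₀ := fun e => by simp [hS]
  have hK' : IsCompact (K \ ⋃ e ∈ S, (ψ e).source) :=
    hK.diff (isOpen_biUnion fun e _ => (ψ e).open_source)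
  have hcl : IsClosed (p '' (K \ ⋃ e ∈ S, (ψ e).source)) :=
    (hK'.image hp.continuous).isClosed
  have hb₀ : b₀ ∉ p '' (K \ ⋃ e ∈ S, (ψ e).source) := by
    rintro ⟨e, ⟨heK, he⟩, rfl⟩
    exact he (mem_biUnion (show e ∈ S from (hSmem e).2 ⟨heK, rfl⟩) (hψmem e))
  have htgt : ∀ e ∈ S, (ψ e).target ∈ 𝓝 b₀ := fun e he => by
    refine (ψ e).open_target.mem_nhds ?_
    rw [← ((hSmem e).1 he).2, ← hψ e]
    exact (ψ e).map_source (hψmem e)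
  have hev : ∀ᶠ b in 𝓝 b₀, (∑ᶠ e ∈ p ⁻¹' {b}, F e) = ∑ e ∈ S, F ((ψ e).symm b) := by
    have h1 : ∀ᶠ b in 𝓝 b₀, ∀ e ∈ S, b ∈ (ψ e).target :=
      (Filter.eventually_all_finset S).2 htgt
    filter_upwards [h1, hcl.isOpen_compl.mem_nhds hb₀] with b hb1 hb2
    have hinj : Set.InjOn (fun e => (ψ e).symm b) S := by
      intro e he e' he' hee
      by_contra hne
      have hd := hdisj (by simpa using (hSmem e).1 he) (by simpa using (hSmem e').1 he') hne
      refine Set.disjoint_left.1 hd (hψU e ((ψ e).map_target (hb1 e he))) ?_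
      simp only at hee
      rw [hee]
      exact hψU e' ((ψ e').map_target (hb1 e' he'))
    rw [← Finset.sum_image hinj]
    refine finsum_mem_eq_sum_of_subset _ ?_ ?_
    · rintro x ⟨hxb, hx0⟩
      have hxb' : p x = b := hxb
      have hxK := hFK x hx0
      by_contra hx
      apply hb2
      refine ⟨x, ⟨hxK, fun hxU => hx ?_⟩, hxb'⟩
      obtain ⟨e, he, hxe⟩ := mem_iUnion₂.1 hxU
      rw [Finset.coe_image]
      refine ⟨e, he, ?_⟩
      simp only
      rw [← hxb', ← hψ e]
      exact (ψ e).left_inv hxe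
    · intro x hx
      rw [Finset.coe_image] at hx
      obtain ⟨e, he, rfl⟩ := hx
      change p ((ψ e).symm b) = b
      rw [← hψ e]
      exact (ψ e).right_inv (hb1 e he)
  refine ContinuousAt.congr ?_ (hev.mono fun b hb => hb.symm)
  refine tendsto_finsetSum _ fun e he => ?_
  refine (hF.continuousAt).comp ?_
  exact (ψ e).symm.continuousAt (mem_of_mem_nhds (htgt e he))

end FiberSum

namespace ConvAlg

variable {X : Type u} [TopologicalSpace X] {r : Setoid X}

noncomputable instance : AddCommGroup (ConvAlg r) :=
  inferInstanceAs (AddCommGroup C_c(RelGroupoid r, ℂ))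

noncomputable instance : Module ℂ (ConvAlg r) :=
  inferInstanceAs (Module ℂ C_c(RelGroupoid r, ℂ))

/-- The underlying function of an element of `C_c(𝒢)`. -/
noncomputable def toFun (f : ConvAlg r) : RelGroupoid r → ℂ :=
  fun γ => (show C_c(RelGroupoid r, ℂ) from f) γ

open Classical in
/-- The value `f(x, y)` of `f ∈ C_c(𝒢)`, extended by `0` to pairs `(x, y)` that are not in `𝒢`. -/
noncomputable def kernel (f : ConvAlg r) (x y : X) : ℂ :=
  if h : r x y then f.toFun ⟨(x, y), h⟩ else 0

theorem toFun_continuous (f : ConvAlg r) : Continuous f.toFun :=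
  (show C_c(RelGroupoid r, ℂ) from f).continuous

theorem toFun_hasCompactSupport (f : ConvAlg r) : HasCompactSupport f.toFun :=
  (show C_c(RelGroupoid r, ℂ) from f).hasCompactSupport

/-- Build an element of `C_c(𝒢)` from a function. -/
noncomputable def mk (F : RelGroupoid r → ℂ) (hc : Continuous F) (hs : HasCompactSupport F) : ConvAlg r :=
  (⟨⟨F, hc⟩, hs⟩ : C_c(RelGroupoid r, ℂ))

@[simp] theorem toFun_mk (F : RelGroupoid r → ℂ) (hc : Continuous F) (hs : HasCompactSupport F) :
    (mk F hc hs).toFun = F := rfl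

theorem kernel_of_rel (f : ConvAlg r) {x y : X} (h : r x y) :
    f.kernel x y = f.toFun ⟨(x, y), h⟩ := dif_pos h

theorem kernel_of_not_rel (f : ConvAlg r) {x y : X} (h : ¬ r x y) : f.kernel x y = 0 := dif_neg h

theorem rel_of_kernel_ne_zero {f : ConvAlg r} {x y : X} (h : f.kernel x y ≠ 0) : r x y := by
  by_contra h'
  exact h (f.kernel_of_not_rel h')

@[ext] theorem ext {f g : ConvAlg r} (h : ∀ x y, f.kernel x y = g.kernel x y) : f = g := by
  refine CompactlySupportedContinuousMap.ext (f := f) (g := g) ?_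
  rintro ⟨⟨x, y⟩, hxy⟩
  have := h x y
  rw [kernel_of_rel _ hxy, kernel_of_rel _ hxy] at this
  exact this

theorem kernel_add (f g : ConvAlg r) (x y : X) :
    (f + g).kernel x y = f.kernel x y + g.kernel x y := by
  by_cases h : r x y
  · simp only [kernel_of_rel _ h]; rfl
  · simp only [kernel_of_not_rel _ h, add_zero]

theorem kernel_zero (x y : X) : (0 : ConvAlg r).kernel x y = 0 := by
  by_cases h : r x y
  · simp only [kernel_of_rel _ h]; rfl
  · simp only [kernel_of_not_rel _ h]

theorem kernel_smul (c : ℂ) (f : ConvAlg r) (x y : X) :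
    (c • f).kernel x y = c * f.kernel x y := by
  by_cases h : r x y
  · simp only [kernel_of_rel _ h]; rfl
  · simp only [kernel_of_not_rel _ h, mul_zero]

/-- The flip `(x, y) ↦ (y, x)`. -/
def flip : RelGroupoid r ≃ₜ RelGroupoid r where
  toFun γ := ⟨(γ.1.2, γ.1.1), r.symm γ.2⟩
  invFun γ := ⟨(γ.1.2, γ.1.1), r.symm γ.2⟩
  left_inv _ := rfl
  right_inv _ := rfl
  continuous_toFun := by fun_prop
  continuous_invFun := by fun_prop

noncomputable instance : Star (ConvAlg r) where
  star f := mk (fun γ => star (f.toFun (flip γ)))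
    ((f.toFun_continuous.comp flip.continuous).star)
    ((f.toFun_hasCompactSupport.comp_homeomorph flip).comp_left (g := star) (star_zero ℂ))

theorem kernel_star (f : ConvAlg r) (x y : X) : (star f).kernel x y = star (f.kernel y x) := by
  by_cases h : r x y
  · rw [kernel_of_rel _ h, kernel_of_rel _ (r.symm h)]; rfl
  · rw [kernel_of_not_rel _ h, kernel_of_not_rel _ (fun h' => h (r.symm h')), star_zero]

/-- The space of composable pairs `((x, y), (y, z))`, written as triples. -/
abbrev Composable (r : Setoid X) : Type u := {t : X × X × X // r t.1 t.2.1 ∧ r t.2.1 t.2.2}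

/-- The product `((x, y), (y, z)) ↦ (x, z)` of composable pairs. -/
def compose (t : Composable r) : RelGroupoid r := ⟨(t.1.1, t.1.2.2), r.trans t.2.1 t.2.2⟩

/-- The two factors of a composable pair. -/
def factors (t : Composable r) : RelGroupoid r × RelGroupoid r :=
  (⟨(t.1.1, t.1.2.1), t.2.1⟩, ⟨(t.1.2.1, t.1.2.2), t.2.2⟩)

theorem factors_continuous : Continuous (factors (r := r)) := by
  unfold factors; fun_prop

theorem factors_isClosedEmbedding [T2Space X] : IsClosedEmbedding (factors (r := r)) := by
  refine ⟨?_, ?_⟩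
  · have h : IsEmbedding ((fun q : RelGroupoid r × RelGroupoid r =>
        ((q.1.1.1, q.1.1.2, q.2.1.2) : X × X × X)) ∘ factors (r := r)) := by
      exact IsEmbedding.subtypeVal
    exact IsEmbedding.of_comp factors_continuous (by fun_prop) h
  · have : range (factors (r := r)) =
        {q : RelGroupoid r × RelGroupoid r | q.1.1.2 = q.2.1.1} := by
      ext q
      constructor
      · rintro ⟨t, rfl⟩; rfl
      · obtain ⟨⟨⟨x, y⟩, h1⟩, ⟨⟨y', z⟩, h2⟩⟩ := q
        rintro h
        obtain rfl : y = y' := h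
        exact ⟨⟨(x, y, z), h1, h2⟩, rfl⟩
    rw [this]
    exact isClosed_eq (by fun_prop) (by fun_prop)

theorem compose_isLocalHomeomorph [he : IsEtaleRel r] :
    IsLocalHomeomorph (compose (r := r)) := by
  have hr := he.isLocalHomeomorph_range
  refine isLocalHomeomorph_of_open_of_locInj (by unfold compose; fun_prop) ?_ ?_
  · rw [isOpenMap_iff_nhds_le]
    rintro ⟨⟨x₀, y₀, z₀⟩, h1, h2⟩
    intro V hV
    rw [mem_map, nhds_subtype_eq_comap, mem_comap] at hV
    obtain ⟨W, hW, hWV⟩ := hV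
    rw [nhds_prod_eq, nhds_prod_eq] at hW
    obtain ⟨A, hA, T, hT, hAT⟩ := mem_prod_iff.1 hW
    obtain ⟨B, hB, C, hC, hBC⟩ := mem_prod_iff.1 hT
    have hA' : (fun γ : RelGroupoid r => γ.1.1) '' {γ | γ.1.1 ∈ A ∧ γ.1.2 ∈ B} ∈ 𝓝 x₀ := by
      have := hr.isOpenMap.image_mem_nhds (x := ⟨(x₀, y₀), h1⟩)
        (s := {γ : RelGroupoid r | γ.1.1 ∈ A ∧ γ.1.2 ∈ B}) ?_
      · exact this
      · refine inter_mem ?_ ?_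
        · exact (show Continuous fun γ : RelGroupoid r => γ.1.1 by fun_prop).continuousAt.preimage_mem_nhds hA
        · exact (show Continuous fun γ : RelGroupoid r => γ.1.2 by fun_prop).continuousAt.preimage_mem_nhds hB
    have hN : {γ : RelGroupoid r | γ.1.1 ∈ (fun γ : RelGroupoid r => γ.1.1) ''
        {γ | γ.1.1 ∈ A ∧ γ.1.2 ∈ B} ∧ γ.1.2 ∈ C} ∈
        𝓝 (compose (⟨(x₀, y₀, z₀), h1, h2⟩ : Composable r)) := by
      refine inter_mem ?_ ?_
      · exact (show Continuous fun γ : RelGroupoid r => γ.1.1 by fun_prop).continuousAt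
          (x := compose (⟨(x₀, y₀, z₀), h1, h2⟩ : Composable r)) hA'
      · exact (show Continuous fun γ : RelGroupoid r => γ.1.2 by fun_prop).continuousAt.preimage_mem_nhds hC
    refine mem_of_superset hN ?_
    rintro ⟨⟨x, z⟩, hxz⟩ ⟨⟨⟨⟨x', y⟩, hxy⟩, ⟨hxA, hyB⟩, hx'⟩, hzC⟩
    obtain rfl : x' = x := hx'
    exact hWV (a := ⟨(x', y, z), hxy, r.trans (r.symm hxy) hxz⟩)
      (hAT ⟨hxA, hBC ⟨hyB, hzC⟩⟩)
  · rintro ⟨⟨x₀, y₀, z₀⟩, h1, h2⟩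
    obtain ⟨φ, hmem, hφ⟩ := hr ⟨(x₀, y₀), h1⟩
    refine ⟨(fun t : Composable r => (factors t).1) ⁻¹' φ.source,
      φ.open_source.preimage (continuous_fst.comp factors_continuous), hmem, ?_⟩
    rintro ⟨⟨x, y, z⟩, hxy, hyz⟩ ht ⟨⟨x', y', z'⟩, hxy', hyz'⟩ ht' heq
    have e1 : x = x' := congrArg (fun γ : RelGroupoid r => γ.1.1) heq
    have e2 : z = z' := congrArg (fun γ : RelGroupoid r => γ.1.2) heq
    subst e1 e2
    have e3 := φ.injOn ht ht' (by rw [← hφ]; rfl)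
    have e4 : y = y' := congrArg (fun γ : RelGroupoid r => γ.1.2) e3
    subst e4
    rfl

theorem kernel_support_finite [T2Space X] [he : IsEtaleRel r] (f : ConvAlg r) (x : X) :
    {y | f.kernel x y ≠ 0}.Finite := by
  have h := fiber_inter_compact_finite he.isLocalHomeomorph_range
    f.toFun_hasCompactSupport.isCompact x
  refine (h.image (fun γ : RelGroupoid r => γ.1.2)).subset ?_
  intro y hy
  have hxy := rel_of_kernel_ne_zero hy
  refine ⟨⟨(x, y), hxy⟩, ⟨subset_tsupport _ ?_, rfl⟩, rfl⟩
  have hy' : f.kernel x y ≠ 0 := hy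
  rwa [kernel_of_rel f hxy] at hy'

theorem kernel_support_finite_col [T2Space X] [IsEtaleRel r] (f : ConvAlg r) (y : X) :
    {x | f.kernel x y ≠ 0}.Finite := by
  refine ((star f).kernel_support_finite y).subset ?_
  intro x hx
  have hx' : f.kernel x y ≠ 0 := hx
  simpa [kernel_star] using hx'

theorem fiber_compose (f g : ConvAlg r) (γ : RelGroupoid r) :
    (∑ᶠ t ∈ compose (r := r) ⁻¹' {γ}, f.toFun (factors t).1 * g.toFun (factors t).2) =
      ∑ᶠ y, f.kernel γ.1.1 y * g.kernel y γ.1.2 := by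
  obtain ⟨⟨x, z⟩, hxz⟩ := γ
  have h0 : (∑ᶠ y, f.kernel x y * g.kernel y z) =
      ∑ᶠ y ∈ {y | r x y}, f.kernel x y * g.kernel y z := by
    refine finsum_congr fun y => ?_
    by_cases h : r x y
    · simp [h]
    · simp [h, kernel_of_not_rel _ h]
  simp only
  rw [h0]
  refine finsum_mem_eq_of_bijOn (fun t : Composable r => t.1.2.1) ⟨?_, ?_, ?_⟩ ?_
  · rintro ⟨⟨x', y, z'⟩, h1, h2⟩ ht
    have e : x' = x := congrArg (fun γ : RelGroupoid r => γ.1.1) ht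
    subst e
    exact h1
  · rintro ⟨⟨x', y, z'⟩, h1, h2⟩ ht ⟨⟨x'', y', z''⟩, h1', h2'⟩ ht' hy
    have e1 : x' = x := congrArg (fun γ : RelGroupoid r => γ.1.1) ht
    have e2 : z' = z := congrArg (fun γ : RelGroupoid r => γ.1.2) ht
    have e3 : x'' = x := congrArg (fun γ : RelGroupoid r => γ.1.1) ht'
    have e4 : z'' = z := congrArg (fun γ : RelGroupoid r => γ.1.2) ht'
    have e5 : y = y' := hy
    subst e1 e2 e3 e4 e5
    rfl
  · intro y hy
    exact ⟨⟨(x, y, z), hy, r.trans (r.symm hy) hxz⟩, rfl, rfl⟩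
  · rintro ⟨⟨x', y, z'⟩, h1, h2⟩ ht
    have e1 : x' = x := congrArg (fun γ : RelGroupoid r => γ.1.1) ht
    have e2 : z' = z := congrArg (fun γ : RelGroupoid r => γ.1.2) ht
    subst e1 e2
    simp only
    rw [kernel_of_rel _ h1, kernel_of_rel _ h2]
    rfl

theorem factors_compact [T2Space X] (f g : ConvAlg r) :
    IsCompact (factors (r := r) ⁻¹' (tsupport f.toFun ×ˢ tsupport g.toFun)) :=
  factors_isClosedEmbedding.isCompact_preimage
    (f.toFun_hasCompactSupport.isCompact.prod g.toFun_hasCompactSupport.isCompact)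

theorem mem_factors_of_ne_zero (f g : ConvAlg r) (t : Composable r)
    (ht : f.toFun (factors t).1 * g.toFun (factors t).2 ≠ 0) :
    t ∈ factors (r := r) ⁻¹' (tsupport f.toFun ×ˢ tsupport g.toFun) :=
  ⟨subset_tsupport _ (left_ne_zero_of_mul ht), subset_tsupport _ (right_ne_zero_of_mul ht)⟩

theorem conv_continuous [T2Space X] [IsEtaleRel r] (f g : ConvAlg r) :
    Continuous (fun γ : RelGroupoid r => ∑ᶠ y, f.kernel γ.1.1 y * g.kernel y γ.1.2) := by
  simp only [← fiber_compose]
  exact continuous_fiberSum compose_isLocalHomeomorph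
    ((f.toFun_continuous.comp (continuous_fst.comp factors_continuous)).mul
      (g.toFun_continuous.comp (continuous_snd.comp factors_continuous)))
    (factors_compact f g) (mem_factors_of_ne_zero f g)

theorem conv_hasCompactSupport [T2Space X] [IsEtaleRel r] (f g : ConvAlg r) :
    HasCompactSupport
      (fun γ : RelGroupoid r => ∑ᶠ y, f.kernel γ.1.1 y * g.kernel y γ.1.2) := by
  refine HasCompactSupport.intro
    ((factors_compact f g).image (compose_isLocalHomeomorph (r := r)).continuous) ?_
  intro γ hγ
  rw [← fiber_compose]
  refine finsum_mem_of_eqOn_zero ?_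
  intro t ht
  by_contra h
  exact hγ ⟨t, mem_factors_of_ne_zero f g t h, ht⟩

/-- The convolution product `(f * g)(x, z) = ∑_{y ∼ x} f(x, y) g(y, z)`. -/
noncomputable instance [T2Space X] [IsEtaleRel r] : Mul (ConvAlg r) where
  mul f g := mk (fun γ => ∑ᶠ y, f.kernel γ.1.1 y * g.kernel y γ.1.2)
    (conv_continuous f g) (conv_hasCompactSupport f g)

theorem kernel_mul [T2Space X] [IsEtaleRel r] (f g : ConvAlg r) (x z : X) :
    (f * g).kernel x z = ∑ᶠ y, f.kernel x y * g.kernel y z := by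
  by_cases h : r x z
  · rw [kernel_of_rel _ h]; rfl
  · rw [kernel_of_not_rel _ h]
    symm
    refine finsum_eq_zero_of_forall_eq_zero fun y => ?_
    by_contra hne
    exact h (r.trans (rel_of_kernel_ne_zero (left_ne_zero_of_mul hne))
      (rel_of_kernel_ne_zero (right_ne_zero_of_mul hne)))

theorem kernel_mul_eq_sum [T2Space X] [IsEtaleRel r] (f g : ConvAlg r) (x z : X) (S : Finset X)
    (hS : ∀ y, f.kernel x y ≠ 0 → y ∈ S) :
    (f * g).kernel x z = ∑ y ∈ S, f.kernel x y * g.kernel y z := by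
  rw [kernel_mul]
  refine finsum_eq_sum_of_support_subset _ ?_
  intro y hy
  exact hS y (left_ne_zero_of_mul hy)

theorem kernel_mul_eq_sum' [T2Space X] [IsEtaleRel r] (f g : ConvAlg r) (x z : X) (S : Finset X)
    (hS : ∀ y, g.kernel y z ≠ 0 → y ∈ S) :
    (f * g).kernel x z = ∑ y ∈ S, f.kernel x y * g.kernel y z := by
  rw [kernel_mul]
  refine finsum_eq_sum_of_support_subset _ ?_
  intro y hy
  exact hS y (right_ne_zero_of_mul hy)

noncomputable instance [T2Space X] [IsEtaleRel r] : NonUnitalRing (ConvAlg r) where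
  left_distrib f g h := by
    ext x z
    have hS : ∀ y, f.kernel x y ≠ 0 → y ∈ (f.kernel_support_finite x).toFinset := by simp
    simp only [kernel_add, kernel_mul_eq_sum f _ x z _ hS, mul_add, Finset.sum_add_distrib]
  right_distrib f g h := by
    ext x z
    have hS : ∀ y, h.kernel y z ≠ 0 → y ∈ (h.kernel_support_finite_col z).toFinset := by simp
    simp only [kernel_add, kernel_mul_eq_sum' _ h x z _ hS, add_mul, Finset.sum_add_distrib]
  zero_mul f := by
    ext x z
    simp [kernel_mul, kernel_zero]
  mul_zero f := by
    ext x z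
    simp [kernel_mul, kernel_zero]
  mul_assoc f g h := by
    ext x z
    have hS : ∀ y, f.kernel x y ≠ 0 → y ∈ (f.kernel_support_finite x).toFinset := by simp
    have hT : ∀ y, h.kernel y z ≠ 0 → y ∈ (h.kernel_support_finite_col z).toFinset := by simp
    rw [kernel_mul_eq_sum' _ h x z _ hT, kernel_mul_eq_sum f _ x z _ hS]
    simp only [kernel_mul_eq_sum f g x _ _ hS, kernel_mul_eq_sum' g h _ z _ hT,
      Finset.sum_mul, Finset.mul_sum]
    rw [Finset.sum_comm]
    simp only [mul_assoc]

noncomputable instance [T2Space X] [IsEtaleRel r] : StarRing (ConvAlg r) where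
  star_involutive f := by
    ext x y
    simp [kernel_star]
  star_mul f g := by
    ext x z
    have hS : ∀ y, f.kernel z y ≠ 0 → y ∈ (f.kernel_support_finite z).toFinset := by simp
    have hS' : ∀ y, (star f).kernel y z ≠ 0 → y ∈ (f.kernel_support_finite z).toFinset := by
      simp [kernel_star]
    rw [kernel_star, kernel_mul_eq_sum f g z x _ hS, kernel_mul_eq_sum' _ (star f) x z _ hS']
    simp [kernel_star, mul_comm]
  star_add f g := by
    ext x y
    simp [kernel_star, kernel_add]

instance [T2Space X] [IsEtaleRel r] : StarModule ℂ (ConvAlg r) where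
  star_smul c f := by
    ext x y
    simp [kernel_star, kernel_smul]

instance [T2Space X] [IsEtaleRel r] : IsScalarTower ℂ (ConvAlg r) (ConvAlg r) where
  smul_assoc c f g := by
    ext x z
    have hS : ∀ y, f.kernel x y ≠ 0 → y ∈ (f.kernel_support_finite x).toFinset := by simp
    have hS' : ∀ y, (c • f).kernel x y ≠ 0 → y ∈ (f.kernel_support_finite x).toFinset := by
      simp [kernel_smul]
    simp only [smul_eq_mul]
    rw [kernel_smul, kernel_mul_eq_sum f g x z _ hS, kernel_mul_eq_sum _ g x z _ hS']
    simp [kernel_smul, Finset.mul_sum, mul_assoc]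

instance [T2Space X] [IsEtaleRel r] : SMulCommClass ℂ (ConvAlg r) (ConvAlg r) where
  smul_comm c f g := by
    ext x z
    have hS : ∀ y, f.kernel x y ≠ 0 → y ∈ (f.kernel_support_finite x).toFinset := by simp
    simp only [smul_eq_mul]
    rw [kernel_smul, kernel_mul_eq_sum f g x z _ hS, kernel_mul_eq_sum f _ x z _ hS]
    simp [kernel_smul, Finset.mul_sum, mul_left_comm]

/-- The `I`-norm of `f ∈ C_c(𝒢)`:
`max (sup_x ∑_{y ∼ x} |f(x, y)|, sup_y ∑_{x ∼ y} |f(x, y)|)`. For an étale relation the sums are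
finite and, `f` having compact support, the suprema are finite. -/
noncomputable def iNorm (f : ConvAlg r) : ℝ :=
  max (⨆ x, ∑ᶠ y, ‖f.kernel x y‖) (⨆ y, ∑ᶠ x, ‖f.kernel x y‖)

end ConvAlg

/-- A representation of the groupoid of `r` on a Hilbert space: a `*`-representation of the
convolution algebra `C_c(𝒢)` by bounded operators, bounded with respect to the `I`-norm. -/
structure GroupoidRep {X : Type u} [TopologicalSpace X] [T2Space X] (r : Setoid X)
    [IsEtaleRel r] : Type (u + 1) where
  H : Type u
  [normedAddCommGroup : NormedAddCommGroup H]
  [innerProductSpace : InnerProductSpace ℂ H]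
  [completeSpace : CompleteSpace H]
  hom : ConvAlg r →⋆ₙₐ[ℂ] (H →L[ℂ] H)
  norm_le : ∀ f, ‖hom f‖ ≤ f.iNorm

attribute [instance] GroupoidRep.normedAddCommGroup GroupoidRep.innerProductSpace
  GroupoidRep.completeSpace

section GroupoidCStar

variable {X : Type u} [TopologicalSpace X] [T2Space X] (r : Setoid X) [IsEtaleRel r]

/-- The C*-algebra of bounded families of operators, one on the Hilbert space of each
representation, with the supremum norm. -/
def RepProduct : Type (u + 1) := lp (fun ρ : GroupoidRep r => ρ.H →L[ℂ] ρ.H) ∞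

noncomputable instance : NonUnitalCStarAlgebra (RepProduct r) :=
  inferInstanceAs (NonUnitalCStarAlgebra (lp (fun ρ : GroupoidRep r => ρ.H →L[ℂ] ρ.H) ∞))

/-- The universal representation `f ↦ (ρ(f))_ρ`. The norm of its value at `f` is the full norm
`sup_ρ ‖ρ(f)‖`. -/
noncomputable def universalRep : ConvAlg r →⋆ₙₐ[ℂ] RepProduct r where
  toFun f := (⟨fun ρ => ρ.hom f, memℓp_infty ⟨f.iNorm, by
    rintro _ ⟨ρ, rfl⟩
    exact ρ.norm_le f⟩⟩ : lp (fun ρ : GroupoidRep r => ρ.H →L[ℂ] ρ.H) ∞)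
  map_smul' c f := by apply Subtype.ext; funext ρ; exact map_smul ρ.hom c f
  map_zero' := by apply Subtype.ext; funext ρ; exact map_zero ρ.hom
  map_add' f g := by apply Subtype.ext; funext ρ; exact map_add ρ.hom f g
  map_mul' f g := by apply Subtype.ext; funext ρ; exact map_mul ρ.hom f g
  map_star' f := by apply Subtype.ext; funext ρ; exact map_star ρ.hom f

/-- The closure of the image of `C_c(𝒢)` under the universal representation. -/
noncomputable def groupoidCStarSubalgebra : NonUnitalStarSubalgebra ℂ (RepProduct r) :=
  (NonUnitalStarAlgHom.range (universalRep r)).topologicalClosure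

instance : IsClosed (groupoidCStarSubalgebra r : Set (RepProduct r)) :=
  NonUnitalStarSubalgebra.isClosed_topologicalClosure _

/-- The (full) groupoid C*-algebra `C*(𝒢)`: the completion of `C_c(𝒢)` in the full norm,
realised as the closure of its image under the universal representation. -/
def GroupoidCStar : Type (u + 1) := ↥(groupoidCStarSubalgebra r)

noncomputable instance : NonUnitalCStarAlgebra (GroupoidCStar r) :=
  inferInstanceAs (NonUnitalCStarAlgebra ↥(groupoidCStarSubalgebra r))

/-- The canonical map `C_c(𝒢) → C*(𝒢)`. -/
noncomputable def toGroupoidCStar : ConvAlg r →⋆ₙₐ[ℂ] GroupoidCStar r where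
  toFun f := ⟨universalRep r f, NonUnitalStarSubalgebra.le_topologicalClosure _ ⟨f, rfl⟩⟩
  map_smul' c f := Subtype.ext (map_smul (universalRep r) c f)
  map_zero' := Subtype.ext (map_zero (universalRep r))
  map_add' f g := Subtype.ext (map_add (universalRep r) f g)
  map_mul' f g := Subtype.ext (map_mul (universalRep r) f g)
  map_star' f := Subtype.ext (map_star (universalRep r) f)

end GroupoidCStar

/-! ## The glued space `N = M^Q ∪_Σ M^P` and its equivalence relation -/

/-- The decomposition `N = M^Q ∪_Σ M^P` with `M^P = k · R` and `Σ = k · Σ_R`: the spaces `M^Q` and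
`M^P = {1, …, k} × R` sit in `N` as closed subspaces which cover `N` and which meet exactly in
`Σ = {1, …, k} × Σ_R`; here `Σ_R` is a subspace of `R`, and `attach` is the inclusion of `Σ` in
`M^Q`. -/
structure Gluing (k : ℕ) (N : Type u) (MQ : Type v) (R : Type w)
    [TopologicalSpace N] [TopologicalSpace MQ] [TopologicalSpace R] where
  inclQ : MQ → N
  inclP : Fin k × R → N
  sigmaR : Set R
  attach : Fin k → sigmaR → MQ
  isClosedEmbedding_inclQ : IsClosedEmbedding inclQ
  isClosedEmbedding_inclP : IsClosedEmbedding inclP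
  cover : range inclQ ∪ range inclP = univ
  glue : ∀ i (p : sigmaR), inclQ (attach i p) = inclP (i, (p : R))
  inter : ∀ q i p, inclQ q = inclP (i, p) → p ∈ sigmaR

namespace Gluing

variable {k : ℕ} {N : Type u} {MQ : Type v} {R : Type w}
  [TopologicalSpace N] [TopologicalSpace MQ] [TopologicalSpace R] (D : Gluing k N MQ R)

theorem inclP_notMem_range {i : Fin k} {p : R} (hp : p ∉ D.sigmaR) :
    D.inclP (i, p) ∉ range D.inclQ := by
  rintro ⟨q, hq⟩
  exact hp (D.inter q i p hq)

/-- The equivalence relation on `N`: a point of `M^Q` is equivalent only to itself, and two points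
of `M^P - Σ` are equivalent if and only if they lie over the same point of `R`. -/
def rel : Setoid N where
  r x y := x = y ∨ ∃ p, p ∉ D.sigmaR ∧ ∃ i j, D.inclP (i, p) = x ∧ D.inclP (j, p) = y
  iseqv := by
    refine ⟨fun x => Or.inl rfl, ?_, ?_⟩
    · rintro x y (rfl | ⟨p, hp, i, j, hi, hj⟩)
      · exact Or.inl rfl
      · exact Or.inr ⟨p, hp, j, i, hj, hi⟩
    · rintro x y z (rfl | ⟨p, hp, i, j, hi, hj⟩) h
      · exact h
      · rcases h with rfl | ⟨p', hp', i', j', hi', hj'⟩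
        · exact Or.inr ⟨p, hp, i, j, hi, hj⟩
        · have := D.isClosedEmbedding_inclP.injective (hj.trans hi'.symm)
          obtain ⟨_, rfl⟩ := Prod.mk.inj this
          exact Or.inr ⟨p, hp, i, j', hi, hj'⟩

theorem rel_iff {x y : N} : D.rel x y ↔
    x = y ∨ ∃ p, p ∉ D.sigmaR ∧ ∃ i j, D.inclP (i, p) = x ∧ D.inclP (j, p) = y := Iff.rfl

theorem isClosed_sigmaR_of (i : Fin k) : IsClosed D.sigmaR := by
  have h : D.sigmaR = (fun p => D.inclP (i, p)) ⁻¹' range D.inclQ := by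
    ext p
    constructor
    · intro hp
      exact ⟨D.attach i ⟨p, hp⟩, D.glue i ⟨p, hp⟩⟩
    · rintro ⟨q, hq⟩
      exact D.inter q i p hq
  rw [h]
  exact D.isClosedEmbedding_inclQ.isClosed_range.preimage
    (D.isClosedEmbedding_inclP.continuous.comp (by fun_prop))

theorem isOpen_image_sheet (i : Fin k) {V : Set R} (hV : IsOpen V) (hVs : Disjoint V D.sigmaR) :
    IsOpen ((fun p => D.inclP (i, p)) '' V) := by
  have hW : IsOpen ({i} ×ˢ V : Set (Fin k × R)) := (isOpen_discrete _).prod hV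
  have hcl : IsClosed (range D.inclQ ∪ D.inclP '' ({i} ×ˢ V)ᶜ) :=
    D.isClosedEmbedding_inclQ.isClosed_range.union
      (D.isClosedEmbedding_inclP.isClosedMap _ hW.isClosed_compl)
  have : (fun p => D.inclP (i, p)) '' V = (range D.inclQ ∪ D.inclP '' ({i} ×ˢ V)ᶜ)ᶜ := by
    ext x
    constructor
    · rintro ⟨p, hp, rfl⟩ (h | ⟨a, ha, hax⟩)
      · exact D.inclP_notMem_range (Set.disjoint_left.1 hVs hp) h
      · have := D.isClosedEmbedding_inclP.injective hax
        subst this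
        exact ha ⟨rfl, hp⟩
    · intro hx
      have hx' : x ∈ range D.inclQ ∪ range D.inclP := by rw [D.cover]; trivial
      rcases hx' with h | ⟨⟨j, p⟩, rfl⟩
      · exact absurd (Or.inl h) hx
      · by_cases hjp : (j, p) ∈ ({i} ×ˢ V : Set (Fin k × R))
        · obtain ⟨hj, hp⟩ := hjp
          obtain rfl : j = i := hj
          exact ⟨p, hp, rfl⟩
        · exact absurd (Or.inr ⟨_, hjp, rfl⟩) hx
  rw [this]
  exact hcl.isOpen_compl

/-- The complement in `N` of the sheets of `M^P` other than the `i`-th one. -/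
def sheetNhd (i : Fin k) : Set N := (D.inclP '' ({i}ᶜ ×ˢ univ))ᶜ

theorem isOpen_sheetNhd (i : Fin k) : IsOpen (D.sheetNhd i) :=
  (D.isClosedEmbedding_inclP.isClosedMap _
    ((isClosed_discrete _).prod isClosed_univ)).isOpen_compl

theorem mem_sheetNhd (i j : Fin k) (p : R) : D.inclP (j, p) ∈ D.sheetNhd i ↔ j = i := by
  constructor
  · intro h
    by_contra hne
    exact h ⟨(j, p), ⟨hne, trivial⟩, rfl⟩
  · rintro rfl ⟨⟨j', p'⟩, ⟨hj', _⟩, h⟩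
    exact hj' (Prod.mk.inj (D.isClosedEmbedding_inclP.injective h)).1

/-- The groupoid of the equivalence relation on `N` is étale. -/
instance isEtaleRel_rel : IsEtaleRel D.rel where
  isLocalHomeomorph_range := by
    refine isLocalHomeomorph_of_open_of_locInj (by fun_prop) ?_ ?_
    · rw [isOpenMap_iff_nhds_le]
      rintro ⟨⟨x, y⟩, hxy⟩ V hV
      rw [mem_map, nhds_subtype_eq_comap, mem_comap] at hV
      obtain ⟨W, hW, hWV⟩ := hV
      rw [nhds_prod_eq] at hW
      obtain ⟨A, hA, B, hB, hAB⟩ := mem_prod_iff.1 hW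
      rcases hxy with h | ⟨p, hp, i, j, hi, hj⟩
      · have h' : x = y := h
        subst h'
        refine mem_of_superset (inter_mem hA hB) ?_
        rintro x' ⟨h1, h2⟩
        exact hWV (a := ⟨(x', x'), Or.inl rfl⟩) (hAB ⟨h1, h2⟩)
      · simp only at hi hj
        subst hi hj
        have hc : ∀ l : Fin k, Continuous fun p => D.inclP (l, p) := fun l =>
          D.isClosedEmbedding_inclP.continuous.comp (by fun_prop)
        have hV' : (fun p => D.inclP (i, p)) ⁻¹' A ∩ (fun p => D.inclP (j, p)) ⁻¹' B ∩
            D.sigmaRᶜ ∈ 𝓝 p :=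
          inter_mem (inter_mem ((hc i).continuousAt.preimage_mem_nhds hA)
            ((hc j).continuousAt.preimage_mem_nhds hB))
            ((D.isClosed_sigmaR_of i).isOpen_compl.mem_nhds hp)
        obtain ⟨O, hO, hOo, hpO⟩ := mem_nhds_iff.1 hV'
        have := D.isOpen_image_sheet i hOo
          (Set.disjoint_left.2 fun a ha => (hO ha).2)
        refine mem_of_superset (this.mem_nhds ⟨p, hpO, rfl⟩) ?_
        rintro _ ⟨p', hp', rfl⟩
        exact hWV (a := ⟨(D.inclP (i, p'), D.inclP (j, p')),
          Or.inr ⟨p', (hO hp').2, i, j, rfl, rfl⟩⟩) (hAB ⟨(hO hp').1.1, (hO hp').1.2⟩)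
    · rintro ⟨⟨x, y⟩, hxy⟩
      by_cases hy : ∃ j p, D.inclP (j, p) = y
      · obtain ⟨j, p, rfl⟩ := hy
        refine ⟨{γ | γ.1.2 ∈ D.sheetNhd j}, (D.isOpen_sheetNhd j).preimage (by fun_prop),
          (D.mem_sheetNhd _ _ _).2 rfl, ?_⟩
        have key : ∀ a b, D.rel a b → a ∈ D.sheetNhd j → b ∈ D.sheetNhd j → a = b := by
          rintro _ _ (h | ⟨p, _, l, m, rfl, rfl⟩) ha hb
          · exact h
          · rw [(D.mem_sheetNhd _ _ _).1 ha, (D.mem_sheetNhd _ _ _).1 hb]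
        rintro ⟨⟨a, b⟩, hab⟩ hb ⟨⟨a', b'⟩, hab'⟩ hb' he
        have he' : a = a' := he
        subst he'
        have hbb : b = b' := key b b' (D.rel.trans (D.rel.symm hab) hab') hb hb'
        subst hbb
        rfl
      · refine ⟨{γ | γ.1.2 ∈ (range D.inclP)ᶜ},
          D.isClosedEmbedding_inclP.isClosed_range.isOpen_compl.preimage (by fun_prop), ?_, ?_⟩
        · rintro ⟨⟨j, p⟩, h⟩
          exact hy ⟨j, p, h⟩
        · have key : ∀ a b, D.rel a b → b ∈ (range D.inclP)ᶜ → a = b := by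
            rintro _ _ (h | ⟨p, _, l, m, rfl, rfl⟩) hb
            · exact h
            · exact absurd ⟨_, rfl⟩ hb
          rintro ⟨⟨a, b⟩, hab⟩ hb ⟨⟨a', b'⟩, hab'⟩ hb' he
          have he' : a = a' := he
          subst he'
          have h1 := key a b hab hb
          have h2 := key a b' hab' hb'
          subst h1
          subst h2
          rfl

/-- The C*-algebra of pairs `(f, g) ∈ C₀(M^Q) ⊕ C₀(R, M_k)` such that `g` is diagonal on `Σ_R`,
with diagonal entries the restrictions of `f` to the `k` copies of `Σ_R` in `M^Q`, that is,
`α(f|_Σ) = g|_{Σ_R}` for the diagonal inclusion `α : C₀(Σ) ≅ ⊕ᵢ C₀(Σ_R) → M_k(C₀(Σ_R))`. -/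
def pairAlgebra :
    NonUnitalStarSubalgebra ℂ (C₀(MQ, ℂ) × C₀(R, CStarMatrix (Fin k) (Fin k) ℂ)) where
  carrier := {a | ∀ p : D.sigmaR,
    a.2 (p : R) = CStarMatrix.ofMatrix (Matrix.diagonal fun i => a.1 (D.attach i p))}
  add_mem' := by
    intro a b ha hb p
    ext i j
    by_cases h : i = j <;> simp [ha p, hb p, h]
  zero_mem' := by
    intro p
    ext i j
    by_cases h : i = j <;> simp [h]
  mul_mem' := by
    intro a b ha hb p
    have h : a.2 (p : R) * b.2 (p : R) = _ := congrArg₂ (· * ·) (ha p) (hb p)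
    refine h.trans ?_
    change CStarMatrix.ofMatrix (Matrix.diagonal _ * Matrix.diagonal _) = _
    rw [Matrix.diagonal_mul_diagonal]
    rfl
  smul_mem' := by
    intro c a ha p
    ext i j
    by_cases h : i = j <;> simp [ha p, h]
  star_mem' := by
    intro a ha p
    have h : star (a.2 (p : R)) = _ := congrArg star (ha p)
    refine h.trans ?_
    change CStarMatrix.ofMatrix (star (Matrix.diagonal _)) = _
    rw [Matrix.star_eq_conjTranspose, Matrix.diagonal_conjTranspose]
    rfl

end Gluing

/-! ## Norm estimates for `*`-homomorphisms -/

/-! The orbits of the relation are finite of bounded size, so an element `h` of the convolution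
algebra is a family of finite matrices, one for each orbit, and `pairMap h` is this family. A point
of `M^Q` gives a scalar. A point `p` of `R` gives a `k × k` matrix, which is diagonal when `p` lies
in `Σ_R`, because the points over `p` are then pairwise inequivalent.

The main point is that `pairMap` is isometric for the full norm (`norm_pairMap`). Restriction to a
finite invariant set is multiplicative and, by the Schur test, bounded by the `I`-norm. It is thus
one of the representations that define the full norm, so `‖pairMap h‖` is at most the full norm of
`h`. Conversely, the full norm is at most the `I`-norm, which is at most `k + 1` times the largest
`|h(x, y)|`, hence at most `(k + 1) * ‖pairMap h‖`. Both norms satisfy the C*-identity, and applying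
the estimate to high powers of `star h * h` removes the constant (`le_of_le_mul_of_cstar`).

The image of `pairMap` is dense in the closed algebra `A` (`exists_norm_pairMap_sub_le`). A pair in
`A` is a continuous function `K` on the groupoid with compact sets `{ε ≤ ‖K‖}`, because the groupoid
is a finite union of closed pieces: the units in `M^Q`, the units in each sheet, and the pairs
between different sheets. Cutting `K` off at height `ε` makes its support compact. The isometry
therefore extends to an isomorphism of the completion with `A`.

The exact sequence is then read off from `A`. The kernel of the first projection consists of matrix
functions vanishing on `Σ_R`, that is, of `C₀(R - Σ_R) ⊗ M_k`; since `M_k` is finite-dimensional,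
the algebraic tensor product suffices. The projection is onto because `f` extends from `M^Q` to `N`
by Tietze, and the restrictions of the extension to the sheets give a diagonal `g`. -/

/-- If `x > y > 0`, the powers of `x / y` outgrow every constant `C`. -/
theorem le_of_forall_pow_two_pow_le {x y C : ℝ} (hy : 0 ≤ y)
    (h : ∀ n : ℕ, x ^ 2 ^ n ≤ C * y ^ 2 ^ n) : x ≤ y := by
  by_contra! hlt
  have hx0 : 0 < x := hy.trans_lt hlt
  rcases hy.eq_or_lt with rfl | hy0
  · have := h 0
    simp at this
    linarith
  · obtain ⟨n, hn⟩ := pow_unbounded_of_one_lt C ((one_lt_div hy0).2 hlt)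
    have h1 : (x / y) ^ n ≤ (x / y) ^ 2 ^ n :=
      pow_le_pow_right₀ ((one_lt_div hy0).2 hlt).le (Nat.lt_two_pow_self).le
    have h2 : (x / y) ^ 2 ^ n ≤ C := by
      rw [div_pow, div_le_iff₀ (by positivity)]
      exact h n
    linarith

theorem max_sq_of_nonneg {x y : ℝ} (hx : 0 ≤ x) (hy : 0 ≤ y) :
    max (x ^ 2) (y ^ 2) = max x y ^ 2 := by
  rcases le_total x y with h | h
  · rw [max_eq_right h, max_eq_right (by gcongr)]
  · rw [max_eq_left h, max_eq_left (by gcongr)]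

section CStar

variable {B : Type*} [NonUnitalRing B] [StarRing B]

/-- On self-adjoint elements the C*-identity says that `p` commutes with squaring. Iterated squaring
stands in for powers because `B` need not have a unit. -/
theorem map_iterate_mul_self_of_cstar {p : B → ℝ} (hp : ∀ b, p (star b * b) = p b ^ 2) {a : B}
    (ha : IsSelfAdjoint a) (n : ℕ) :
    IsSelfAdjoint ((fun b => b * b)^[n] a) ∧ p ((fun b => b * b)^[n] a) = p a ^ 2 ^ n := by
  induction n with
  | zero => simpa using ha
  | succ n ih =>
    rw [Function.iterate_succ_apply']
    obtain ⟨h1, h2⟩ := ih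
    set c := (fun b => b * b)^[n] a
    refine ⟨h1.commute_iff h1 |>.1 (Commute.refl c), ?_⟩
    have h3 := hp c
    rw [h1.star_eq] at h3
    rw [h3, h2, ← pow_mul, ← pow_succ]

/-- If a C*-seminorm is bounded by a multiple of another one, then it is bounded by the other
one. -/
theorem le_of_le_mul_of_cstar {p q : B → ℝ} (hp0 : ∀ b, 0 ≤ p b) (hq0 : ∀ b, 0 ≤ q b)
    (hp : ∀ b, p (star b * b) = p b ^ 2) (hq : ∀ b, q (star b * b) = q b ^ 2) (C : ℝ)
    (h : ∀ b, q b ≤ C * p b) (b : B) : q b ≤ p b := by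
  -- The constant `C` enters only once, however large the power of `star b * b`.
  have key : q (star b * b) ≤ p (star b * b) := by
    refine le_of_forall_pow_two_pow_le (C := C) (hp0 _) fun n => ?_
    have hs : IsSelfAdjoint (star b * b) := IsSelfAdjoint.star_mul_self b
    rw [← (map_iterate_mul_self_of_cstar hq hs n).2, ← (map_iterate_mul_self_of_cstar hp hs n).2]
    exact h _
  rw [hp, hq] at key
  exact (sq_le_sq₀ (hq0 b) (hp0 b)).1 key

end CStar

/-- A densely defined norm-preserving linear map extends to a linear isometry. -/
theorem exists_linearIsometry_of_norm_eq {B E F : Type*} [AddCommGroup B] [Module ℂ B]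
    [NormedAddCommGroup E] [NormedSpace ℂ E] [NormedAddCommGroup F] [NormedSpace ℂ F]
    [CompleteSpace E] [CompleteSpace F] (j : B →ₗ[ℂ] E) (π : B → F)
    (hadd : ∀ b c, π (b + c) = π b + π c) (hsmul : ∀ (z : ℂ) b, π (z • b) = z • π b)
    (hj : DenseRange j)
    (h : ∀ b, ‖π b‖ = ‖j b‖) :
    ∃ Ψ : E →ₗᵢ[ℂ] F, (∀ b, Ψ (j b) = π b) ∧ range Ψ = closure (range π) := by
  obtain ⟨π, rfl⟩ : ∃ P : B →ₗ[ℂ] F, ⇑P = π := ⟨⟨⟨π, hadd⟩, hsmul⟩, rfl⟩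
  have hb : ∃ C, ∀ b, ‖π b‖ ≤ C * ‖j b‖ := ⟨1, fun b => by rw [one_mul, h]⟩
  have hΨ : ∀ b, π.extendOfNorm j (j b) = π b := LinearMap.extendOfNorm_eq hj hb
  let Ψ : E →ₗᵢ[ℂ] F := ⟨π.extendOfNorm j, fun x =>
    hj.induction_on (p := fun x => ‖π.extendOfNorm j x‖ = ‖x‖) x
      (isClosed_eq (by fun_prop) (by fun_prop)) fun b => by rw [hΨ, h]⟩
  refine ⟨Ψ, hΨ, Subset.antisymm ?_ ?_⟩
  · rintro _ ⟨x, rfl⟩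
    exact hj.induction_on (p := fun x => Ψ x ∈ closure (range π)) x
      (isClosed_closure.preimage Ψ.continuous) fun b => by
        rw [show Ψ (j b) = π b from hΨ b]; exact subset_closure ⟨b, rfl⟩
  · refine closure_minimal ?_ Ψ.isometry.isClosedEmbedding.isClosed_range
    rintro _ ⟨b, rfl⟩
    exact ⟨j b, hΨ b⟩

/-! ## Matrix norms -/

section Matrix

variable {n : Type*} [Fintype n] [DecidableEq n]

open Matrix in
/-- The Schur test. -/
theorem Matrix.norm_toEuclideanCLM_le_of_sum_le (M : Matrix n n ℂ) {S : ℝ} (hS : 0 ≤ S)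
    (hrow : ∀ i, ∑ j, ‖M i j‖ ≤ S) (hcol : ∀ j, ∑ i, ‖M i j‖ ≤ S) :
    ‖Matrix.toEuclideanCLM (n := n) (𝕜 := ℂ) M‖ ≤ S := by
  refine ContinuousLinearMap.opNorm_le_bound _ hS fun x => ?_
  refine abs_le_of_sq_le_sq' ?_ (by positivity) |>.2
  rw [EuclideanSpace.norm_sq_eq, mul_pow, EuclideanSpace.norm_sq_eq]
  have h1 : ∀ i, ‖(Matrix.toEuclideanCLM (n := n) (𝕜 := ℂ) M x) i‖ ^ 2 ≤
      S * ∑ j, ‖M i j‖ * ‖x j‖ ^ 2 := by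
    intro i
    have e : (Matrix.toEuclideanCLM (n := n) (𝕜 := ℂ) M x) i = ∑ j, M i j * x j := rfl
    rw [e]
    have h2 : ‖∑ j, M i j * x j‖ ≤ ∑ j, ‖M i j‖ * ‖x j‖ :=
      (norm_sum_le _ _).trans (by simp)
    -- Cauchy–Schwarz with the weights `‖M i j‖`, half of each weight going to either factor.
    have h3 : (∑ j, ‖M i j‖ * ‖x j‖) ^ 2 ≤ (∑ j, ‖M i j‖) * ∑ j, ‖M i j‖ * ‖x j‖ ^ 2 :=
      Finset.sum_sq_le_sum_mul_sum_of_sq_le_mul _ (fun _ _ => by positivity)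
        (fun _ _ => by positivity) (fun _ _ => by apply le_of_eq; ring)
    calc _ ≤ (∑ j, ‖M i j‖ * ‖x j‖) ^ 2 := by gcongr
      _ ≤ _ := h3
      _ ≤ _ := by gcongr; exact hrow i
  calc _ ≤ ∑ i, S * ∑ j, ‖M i j‖ * ‖x j‖ ^ 2 := Finset.sum_le_sum fun i _ => h1 i
    _ = S * ∑ j, (∑ i, ‖M i j‖) * ‖x j‖ ^ 2 := by
      rw [← Finset.mul_sum, Finset.sum_comm]
      simp only [Finset.sum_mul]
    _ ≤ S * ∑ j, S * ‖x j‖ ^ 2 := by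
      gcongr with j
      exact hcol j
    _ = _ := by rw [← Finset.mul_sum]; ring

/-- The action of complex matrices on Euclidean space. -/
noncomputable def CStarMatrix.toEuclidean :
    CStarMatrix n n ℂ →⋆ₙₐ[ℂ] (EuclideanSpace ℂ n →L[ℂ] EuclideanSpace ℂ n) where
  toFun M := Matrix.toEuclideanCLM (n := n) (𝕜 := ℂ) (CStarMatrix.ofMatrix.symm M)
  map_smul' c _ := map_smul (Matrix.toEuclideanCLM (n := n) (𝕜 := ℂ)) c _
  map_zero' := map_zero (Matrix.toEuclideanCLM (n := n) (𝕜 := ℂ))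
  map_add' _ _ := map_add (Matrix.toEuclideanCLM (n := n) (𝕜 := ℂ)) _ _
  map_mul' _ _ := map_mul (Matrix.toEuclideanCLM (n := n) (𝕜 := ℂ)) _ _
  map_star' _ := map_star (Matrix.toEuclideanCLM (n := n) (𝕜 := ℂ)) _

/-- An injective `*`-homomorphism of C*-algebras is isometric. -/
theorem CStarMatrix.norm_toEuclidean (M : CStarMatrix n n ℂ) :
    ‖CStarMatrix.toEuclidean M‖ = ‖M‖ := by
  have hinj : Function.Injective (CStarMatrix.toEuclidean (n := n)) :=
    fun _ _ h => (Matrix.toEuclideanCLM (n := n) (𝕜 := ℂ)).injective h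
  exact NonUnitalStarAlgHom.norm_map _ hinj M

theorem CStarMatrix.norm_le_of_sum_le (M : CStarMatrix n n ℂ) {S : ℝ} (hS : 0 ≤ S)
    (hrow : ∀ i, ∑ j, ‖M i j‖ ≤ S) (hcol : ∀ j, ∑ i, ‖M i j‖ ≤ S) : ‖M‖ ≤ S := by
  rw [← CStarMatrix.norm_toEuclidean]
  exact Matrix.norm_toEuclideanCLM_le_of_sum_le _ hS hrow hcol

theorem CStarMatrix.norm_le_card_mul (M : CStarMatrix n n ℂ) {c : ℝ} (hc : 0 ≤ c)
    (h : ∀ i j, ‖M i j‖ ≤ c) : ‖M‖ ≤ Fintype.card n * c := by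
  refine M.norm_le_of_sum_le (by positivity) (fun i => ?_) (fun j => ?_)
  · exact (Finset.sum_le_sum fun j _ => h i j).trans (by simp)
  · exact (Finset.sum_le_sum fun i _ => h i j).trans (by simp)

end Matrix

/-! ## Functions vanishing at infinity -/

section ZeroAtInfty

/-- The soft threshold function on `ℂ`: it vanishes on the ball of radius `ε`. -/
noncomputable def softThreshold (ε : ℝ) (z : ℂ) : ℂ := z - ((ε / max ‖z‖ ε : ℝ) : ℂ) * z

theorem continuous_softThreshold {ε : ℝ} (hε : 0 < ε) : Continuous (softThreshold ε) := by
  unfold softThreshold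
  refine continuous_id.sub (Continuous.mul ?_ continuous_id)
  refine Complex.continuous_ofReal.comp (continuous_const.div (by fun_prop) fun z => ?_)
  exact (lt_of_lt_of_le hε (le_max_right _ _)).ne'

theorem softThreshold_eq_zero {ε : ℝ} (hε : 0 < ε) {z : ℂ} (hz : ‖z‖ ≤ ε) :
    softThreshold ε z = 0 := by
  simp [softThreshold, max_eq_right hz, div_self hε.ne']

theorem norm_softThreshold_sub_le {ε : ℝ} (hε : 0 < ε) (z : ℂ) :
    ‖softThreshold ε z - z‖ ≤ ε := by
  have h0 : 0 < max ‖z‖ ε := lt_of_lt_of_le hε (le_max_right _ _)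
  have : softThreshold ε z - z = -(((ε / max ‖z‖ ε : ℝ) : ℂ) * z) := by
    unfold softThreshold; ring
  rw [this, norm_neg, norm_mul, Complex.norm_real, Real.norm_of_nonneg (by positivity),
    div_mul_eq_mul_div, div_le_iff₀ h0]
  gcongr
  exact le_max_left _ _

variable {X Y : Type*} [TopologicalSpace X] [TopologicalSpace Y]

theorem tendsto_zero_cocompact_of_isCompact {V : Type*} [SeminormedAddCommGroup V] {f : X → V}
    (hf : ∀ ε : ℝ, 0 < ε → IsCompact {x | ε ≤ ‖f x‖}) : Tendsto f (cocompact X) (𝓝 0) := by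
  rw [tendsto_zero_iff_norm_tendsto_zero, Metric.tendsto_nhds]
  intro ε hε
  filter_upwards [(hf ε hε).compl_mem_cocompact] with x hx
  simpa using hx

theorem ZeroAtInftyContinuousMap.isCompact_setOf_le_norm {V : Type*} [NormedAddCommGroup V]
    (f : C₀(X, V)) {ε : ℝ} (hε : 0 < ε) : IsCompact {x | ε ≤ ‖f x‖} := by
  have h := (zero_at_infty f).norm
  rw [norm_zero] at h
  obtain ⟨K, hK, hKs⟩ := mem_cocompact.1 (h.eventually_lt_const hε)
  refine hK.of_isClosed_subset (isClosed_le continuous_const (by fun_prop)) fun x hx => ?_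
  by_contra hxK
  exact absurd (show ‖f x‖ < ε from hKs hxK) (not_lt.2 hx)

theorem ZeroAtInftyContinuousMap.norm_le_iff {V : Type*} [NormedAddCommGroup V]
    (f : C₀(X, V)) {c : ℝ} (hc : 0 ≤ c) : ‖f‖ ≤ c ↔ ∀ x, ‖f x‖ ≤ c := by
  rw [← ZeroAtInftyContinuousMap.norm_toBCF_eq_norm]
  exact BoundedContinuousFunction.norm_le hc

theorem ZeroAtInftyContinuousMap.norm_apply_le {V : Type*} [NormedAddCommGroup V]
    (f : C₀(X, V)) (x : X) : ‖f x‖ ≤ ‖f‖ :=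
  (f.norm_le_iff (norm_nonneg f)).1 le_rfl x

/-- Squaring is monotone on nonnegative reals and so commutes with the supremum. This carries the
pointwise C*-identity over to the supremum norm. -/
theorem ZeroAtInftyContinuousMap.norm_eq_norm_sq {V : Type*} [NormedAddCommGroup V]
    (f g : C₀(X, V)) (h : ∀ x, ‖g x‖ = ‖f x‖ ^ 2) : ‖g‖ = ‖f‖ ^ 2 := by
  refine le_antisymm ((g.norm_le_iff (by positivity)).2 fun x => ?_) ?_
  · rw [h x]
    gcongr
    exact f.norm_apply_le x
  · rw [← Real.le_sqrt (norm_nonneg _) (norm_nonneg _)]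
    refine (f.norm_le_iff (Real.sqrt_nonneg _)).2 fun x => Real.le_sqrt_of_sq_le ?_
    rw [← h x]
    exact g.norm_apply_le x

theorem ZeroAtInftyContinuousMap.continuous_apply {V : Type*} [NormedAddCommGroup V] (x : X) :
    Continuous fun f : C₀(X, V) => f x := by
  refine (LipschitzWith.of_dist_le_mul (K := 1) fun f g => ?_).continuous
  rw [dist_eq_norm, dist_eq_norm, NNReal.coe_one, one_mul]
  exact (f - g).norm_apply_le x

/-- Extension by zero from an open subset. -/
noncomputable def ZeroAtInftyContinuousMap.extendZero [T2Space X] {U : Set X} (hU : IsOpen U)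
    (f : C₀(U, ℂ)) : C₀(X, ℂ) where
  toFun := Function.extend Subtype.val f 0
  continuous_toFun := by
    have hz : ∀ x ∉ U, Function.extend Subtype.val f 0 x = 0 := fun x hx =>
      Function.extend_apply' _ _ _ (by rintro ⟨y, rfl⟩; exact hx y.2)
    have hv : ∀ x : U, Function.extend Subtype.val f 0 (x : X) = f x := fun x =>
      Subtype.val_injective.extend_apply _ _ _
    rw [continuous_iff_continuousAt]
    intro x
    by_cases hx : x ∈ U
    · have h1 : ContinuousAt (Function.extend Subtype.val f 0 ∘ (Subtype.val : U → X)) ⟨x, hx⟩ := by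
        rw [Function.extend_comp Subtype.val_injective]
        exact f.continuous.continuousAt
      exact (hU.isOpenEmbedding_subtypeVal.continuousAt_iff).1 h1
    · rw [ContinuousAt, hz x hx, tendsto_zero_iff_norm_tendsto_zero, Metric.tendsto_nhds]
      intro ε hε
      -- The set `{ε ≤ ‖f‖}` is compact in `U`, hence closed in the Hausdorff space `X`, and its
      -- complement is a neighbourhood of `x`.
      have hc : IsClosed (Subtype.val '' {y : U | ε ≤ ‖f y‖}) :=
        ((f.isCompact_setOf_le_norm hε).image continuous_subtype_val).isClosed
      filter_upwards [hc.isOpen_compl.mem_nhds (by rintro ⟨y, _, rfl⟩; exact hx y.2)] with z hzc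
      rw [dist_zero_right, norm_norm]
      by_cases hzU : z ∈ U
      · rw [hv ⟨z, hzU⟩]
        by_contra hcon
        exact hzc ⟨⟨z, hzU⟩, not_lt.1 hcon, rfl⟩
      · rwa [hz z hzU, norm_zero]
  zero_at_infty' := by
    refine tendsto_zero_cocompact_of_isCompact fun ε hε => ?_
    convert (f.isCompact_setOf_le_norm hε).image continuous_subtype_val
    ext x
    constructor
    · intro hx
      by_cases hxU : x ∈ U
      · refine ⟨⟨x, hxU⟩, ?_, rfl⟩
        have := Subtype.val_injective.extend_apply f 0 (⟨x, hxU⟩ : U)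
        simp only [mem_ofPred_eq] at hx ⊢
        rwa [← this]
      · rw [mem_ofPred_eq, Function.extend_apply' _ _ _ (by rintro ⟨y, rfl⟩; exact hxU y.2)] at hx
        simp at hx
        linarith
    · rintro ⟨y, hy, rfl⟩
      rw [mem_ofPred_eq, Subtype.val_injective.extend_apply]
      exact hy

theorem ZeroAtInftyContinuousMap.extendZero_apply [T2Space X] {U : Set X} (hU : IsOpen U)
    (f : C₀(U, ℂ)) (x : U) : f.extendZero hU x = f x :=
  Subtype.val_injective.extend_apply _ _ _

theorem ZeroAtInftyContinuousMap.extendZero_of_notMem [T2Space X] {U : Set X} (hU : IsOpen U)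
    (f : C₀(U, ℂ)) {x : X} (hx : x ∉ U) : f.extendZero hU x = 0 :=
  Function.extend_apply' _ _ _ (by rintro ⟨y, rfl⟩; exact hx y.2)

theorem ZeroAtInftyContinuousMap.extendZero_add [T2Space X] {U : Set X} (hU : IsOpen U)
    (f g : C₀(U, ℂ)) (x : X) :
    (f + g).extendZero hU x = f.extendZero hU x + g.extendZero hU x := by
  by_cases hx : x ∈ U
  · exact ((f + g).extendZero_apply hU ⟨x, hx⟩).trans (congrArg₂ (· + ·)
      (f.extendZero_apply hU ⟨x, hx⟩).symm (g.extendZero_apply hU ⟨x, hx⟩).symm)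
  · simp only [extendZero_of_notMem hU _ hx, add_zero]

theorem ZeroAtInftyContinuousMap.extendZero_smul [T2Space X] {U : Set X} (hU : IsOpen U) (c : ℂ)
    (f : C₀(U, ℂ)) (x : X) : (c • f).extendZero hU x = c * f.extendZero hU x := by
  by_cases hx : x ∈ U
  · exact ((c • f).extendZero_apply hU ⟨x, hx⟩).trans
      (congrArg (c * ·) (f.extendZero_apply hU ⟨x, hx⟩).symm)
  · simp only [extendZero_of_notMem hU _ hx, mul_zero]

/-- Restriction to a subset outside of which the function vanishes. -/
noncomputable def ZeroAtInftyContinuousMap.restrictOfEqZero (f : C₀(X, ℂ)) {U : Set X}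
    (hf : ∀ x ∉ U, f x = 0) : C₀(U, ℂ) where
  toFun x := f x
  continuous_toFun := by fun_prop
  zero_at_infty' := by
    refine tendsto_zero_cocompact_of_isCompact fun ε hε => ?_
    -- The set `{ε ≤ ‖f‖}` in `X` lies inside `U`, so its compactness may be tested in `X`.
    rw [IsInducing.subtypeVal.isCompact_iff]
    convert f.isCompact_setOf_le_norm hε
    ext x
    constructor
    · rintro ⟨y, hy, rfl⟩
      exact hy
    · intro hx
      by_cases hxU : x ∈ U
      · exact ⟨⟨x, hxU⟩, hx, rfl⟩
      · rw [mem_ofPred_eq, hf x hxU, norm_zero] at hx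
        linarith

/-- Tietze extension for functions vanishing at infinity. -/
theorem ZeroAtInftyContinuousMap.exists_extension [T2Space X] [LocallyCompactSpace X]
    {e : Y → X} (he : IsClosedEmbedding e) (f : C₀(Y, ℂ)) :
    ∃ F : C₀(X, ℂ), ∀ y, F (e y) = f y := by
  have : T2Space Y := he.isEmbedding.t2Space
  have : LocallyCompactSpace Y := he.locallyCompactSpace
  -- A closed embedding is proper, so it extends to the one-point compactifications. These are
  -- compact Hausdorff, hence normal, and the usual Tietze theorem applies to `f` extended by `0` at
  -- infinity. The extension then also vanishes at infinity.
  have hcont : Continuous (OnePoint.map e) := by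
    refine OnePoint.continuous_map he.continuous ?_
    rw [coclosedCompact_eq_cocompact, coclosedCompact_eq_cocompact]
    exact he.tendsto_cocompact
  have hinj : Function.Injective (OnePoint.map e) := Option.map_injective he.injective
  let f' : C(OnePoint Y, ℂ) :=
    ⟨fun y => OnePoint.elim y 0 f, by
      rw [OnePoint.continuous_iff]
      refine ⟨?_, f.continuous⟩
      rw [coclosedCompact_eq_cocompact]
      exact zero_at_infty f⟩
  obtain ⟨g, hg⟩ := f'.exists_extension' (hcont.isClosedEmbedding hinj)
  have hg' : ∀ y, g (OnePoint.map e y) = f' y := fun y => congrFun hg y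
  refine ⟨⟨⟨fun x => g (x : OnePoint X), g.continuous.comp OnePoint.continuous_coe⟩, ?_⟩, fun y => hg' y⟩
  have h1 : Tendsto g (𝓝 OnePoint.infty) (𝓝 (g OnePoint.infty)) := g.continuous.tendsto _
  have h2 : g OnePoint.infty = 0 := hg' OnePoint.infty
  rw [h2] at h1
  refine h1.comp ?_
  rw [← coclosedCompact_eq_cocompact]
  exact OnePoint.tendsto_coe_infty

/-- The matrix-valued function with given entries. -/
noncomputable def ZeroAtInftyContinuousMap.ofEntries {n : Type*} [Fintype n]
    (F : n → n → C₀(X, ℂ)) : C₀(X, CStarMatrix n n ℂ) where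
  toFun x := CStarMatrix.ofMatrix fun i j => F i j x
  -- The topology of `CStarMatrix` is that of entrywise convergence.
  continuous_toFun := continuous_matrix fun i j => (F i j).continuous
  zero_at_infty' := tendsto_pi_nhds.2 fun i => tendsto_pi_nhds.2 fun j => zero_at_infty (F i j)

/-- An entry of a matrix-valued function. -/
noncomputable def ZeroAtInftyContinuousMap.entry {n : Type*} [Fintype n]
    (g : C₀(X, CStarMatrix n n ℂ)) (i j : n) : C₀(X, ℂ) where
  toFun x := g x i j
  continuous_toFun := (continuous_apply_apply i j).comp g.continuous
  zero_at_infty' := tendsto_pi_nhds.1 (tendsto_pi_nhds.1 (zero_at_infty g) i) j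

end ZeroAtInfty

/-! ## Representations of groupoids with finite orbits -/

section FiniteOrbits

variable {X : Type u} [TopologicalSpace X] {r : Setoid X}

namespace ConvAlg

theorem exists_norm_kernel_le (f : ConvAlg r) : ∃ c, ∀ x y, ‖f.kernel x y‖ ≤ c := by
  obtain ⟨c, hc⟩ := f.toFun_hasCompactSupport.exists_bound_of_continuous f.toFun_continuous
  refine ⟨max c 0, fun x y => ?_⟩
  by_cases h : r x y
  · rw [f.kernel_of_rel h]
    exact (hc _).trans (le_max_left _ _)
  · rw [f.kernel_of_not_rel h, norm_zero]
    exact le_max_right _ _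

theorem finsum_norm_kernel_le (f : ConvAlg r) {m : ℕ} {c : ℝ} (hc : ∀ x y, ‖f.kernel x y‖ ≤ c)
    {x : X} {S : Finset X} (hSm : S.card ≤ m) (hS : ∀ y, r x y → y ∈ S) :
    ∑ᶠ y, ‖f.kernel x y‖ ≤ m * c := by
  have hc0 : 0 ≤ c := (norm_nonneg _).trans (hc x x)
  rw [finsum_eq_sum_of_support_subset (s := S) _ fun y hy =>
    hS y (rel_of_kernel_ne_zero (norm_ne_zero_iff.1 hy))]
  calc _ ≤ ∑ _y ∈ S, c := Finset.sum_le_sum fun y _ => hc x y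
    _ = S.card * c := by simp
    _ ≤ _ := by gcongr

theorem finsum_norm_kernel_le' (f : ConvAlg r) {m : ℕ} {c : ℝ} (hc : ∀ x y, ‖f.kernel x y‖ ≤ c)
    {y : X} {S : Finset X} (hSm : S.card ≤ m) (hS : ∀ x, r y x → x ∈ S) :
    ∑ᶠ x, ‖f.kernel x y‖ ≤ m * c := by
  have h := (star f).finsum_norm_kernel_le (c := c)
    (fun x y => by rw [kernel_star, norm_star]; exact hc y x) hSm hS
  simpa only [kernel_star, norm_star] using h

/-- Orbits have at most `m` points, so every row or column sum has at most `m` nonzero terms. This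
is the source of the constant in the comparison of norms. -/
theorem iNorm_le (f : ConvAlg r) {m : ℕ}
    (hm : ∀ x, ∃ S : Finset X, S.card ≤ m ∧ ∀ y, r x y → y ∈ S) {c : ℝ} (hc0 : 0 ≤ c)
    (hc : ∀ x y, ‖f.kernel x y‖ ≤ c) : f.iNorm ≤ m * c := by
  have h0 : 0 ≤ m * c := by positivity
  refine max_le (Real.iSup_le (fun x => ?_) h0) (Real.iSup_le (fun x => ?_) h0) <;>
  obtain ⟨S, hSm, hS⟩ := hm x
  · exact f.finsum_norm_kernel_le hc hSm hS
  · exact f.finsum_norm_kernel_le' hc hSm hS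

/-- A real supremum over an unbounded family is `0` by convention; the bound `m` on the orbits shows
that the row sums are bounded. -/
theorem finsum_norm_kernel_le_iNorm (f : ConvAlg r) {m : ℕ}
    (hm : ∀ x, ∃ S : Finset X, S.card ≤ m ∧ ∀ y, r x y → y ∈ S) (x : X) :
    ∑ᶠ y, ‖f.kernel x y‖ ≤ f.iNorm := by
  obtain ⟨c, hc⟩ := f.exists_norm_kernel_le
  refine le_trans (le_ciSup (f := fun x => ∑ᶠ y, ‖f.kernel x y‖) ⟨m * c, ?_⟩ x) (le_max_left _ _)
  rintro _ ⟨x, rfl⟩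
  obtain ⟨S, hSm, hS⟩ := hm x
  exact f.finsum_norm_kernel_le hc hSm hS

theorem iNorm_star (f : ConvAlg r) : (star f).iNorm = f.iNorm := by
  simp only [iNorm, kernel_star, norm_star]
  exact max_comm _ _

/-- The matrix of values of `f` on a finite family of points. -/
noncomputable def orbitMatrix {n : Type*} (x : n → X) (f : ConvAlg r) : CStarMatrix n n ℂ :=
  CStarMatrix.ofMatrix fun i j => f.kernel (x i) (x j)

theorem orbitMatrix_apply {n : Type*} (x : n → X) (f : ConvAlg r) (i j : n) :
    f.orbitMatrix x i j = f.kernel (x i) (x j) := rfl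

theorem orbitMatrix_star {n : Type*} (x : n → X) (f : ConvAlg r) :
    (star f).orbitMatrix x = star (f.orbitMatrix x) := by
  ext i j
  exact kernel_star f _ _

theorem sum_norm_kernel_le_iNorm [T2Space X] [IsEtaleRel r] {n : Type*} [Fintype n] {x : n → X}
    (hx : Function.Injective x) {m : ℕ}
    (hm : ∀ x, ∃ S : Finset X, S.card ≤ m ∧ ∀ y, r x y → y ∈ S) (f : ConvAlg r) (i : n) :
    ∑ j, ‖f.kernel (x i) (x j)‖ ≤ f.iNorm := by
  classical
  refine le_trans ?_ (f.finsum_norm_kernel_le_iNorm hm (x i))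
  -- Finite support is needed for the `finsum` to be the true row sum and not the default value `0`.
  have hfin := f.kernel_support_finite (x i)
  rw [finsum_eq_sum_of_support_subset (s := hfin.toFinset ∪ Finset.univ.image x) _ ?_,
    ← Finset.sum_image (f := fun y => ‖f.kernel (x i) y‖) (fun a _ b _ h => hx h)]
  · exact Finset.sum_le_sum_of_subset_of_nonneg Finset.subset_union_right
      fun _ _ _ => norm_nonneg _
  · intro y hy
    have : f.kernel (x i) y ≠ 0 := norm_ne_zero_iff.1 hy
    simp [this]

section Orbit

variable {n : Type*} [Fintype n]

/-- This is the Schur test. The column sums are row sums of `star f`, which has the same `I`-norm.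
-/
theorem norm_orbitMatrix_le [DecidableEq n] [T2Space X] [IsEtaleRel r] {x : n → X}
    (hx : Function.Injective x) {m : ℕ}
    (hm : ∀ x, ∃ S : Finset X, S.card ≤ m ∧ ∀ y, r x y → y ∈ S) (f : ConvAlg r) :
    ‖f.orbitMatrix x‖ ≤ f.iNorm := by
  refine CStarMatrix.norm_le_of_sum_le _ ?_ (fun i => ?_) (fun j => ?_)
  · exact le_max_of_le_left (Real.iSup_nonneg fun x => finsum_nonneg fun y => norm_nonneg _)
  · exact f.sum_norm_kernel_le_iNorm hx hm i
  · have h := (star f).sum_norm_kernel_le_iNorm hx hm j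
    simp only [kernel_star, norm_star, iNorm_star] at h
    exact h

/-- By invariance the convolution sum runs over points of the family only, and by injectivity it
meets each of them once. -/
theorem orbitMatrix_mul [T2Space X] [IsEtaleRel r] {x : n → X} (hx : Function.Injective x)
    (hr : ∀ i y, r (x i) y → y ∈ range x) (f g : ConvAlg r) :
    (f * g).orbitMatrix x = f.orbitMatrix x * g.orbitMatrix x := by
  classical
  ext i l
  rw [CStarMatrix.mul_apply, orbitMatrix_apply,
    kernel_mul_eq_sum f g _ _ (Finset.univ.image x) fun y hy => by
      simpa using hr i y (rel_of_kernel_ne_zero hy),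
    Finset.sum_image fun a _ b _ h => hx h]
  rfl

/-- The restriction of `C_c(𝒢)` to a finite invariant set of units, as a `*`-homomorphism to
matrices. -/
noncomputable def orbitHom [T2Space X] [IsEtaleRel r] {x : n → X}
    (hx : Function.Injective x) (hr : ∀ i y, r (x i) y → y ∈ range x) :
    ConvAlg r →⋆ₙₐ[ℂ] CStarMatrix n n ℂ where
  toFun f := f.orbitMatrix x
  map_smul' c f := by ext i j; exact kernel_smul c f _ _
  map_zero' := by ext i j; exact kernel_zero _ _
  map_add' f g := by ext i j; exact kernel_add f g _ _
  map_mul' f g := orbitMatrix_mul hx hr f g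
  map_star' f := orbitMatrix_star x f

end Orbit

end ConvAlg

variable [T2Space X] [IsEtaleRel r]

/-- The representation of the groupoid on a finite invariant set of units. -/
noncomputable def orbitRep {n : Type u} [Fintype n] [DecidableEq n] {x : n → X}
    (hx : Function.Injective x) (hr : ∀ i y, r (x i) y → y ∈ range x) {m : ℕ}
    (hm : ∀ x, ∃ S : Finset X, S.card ≤ m ∧ ∀ y, r x y → y ∈ S) : GroupoidRep r where
  H := EuclideanSpace ℂ n
  hom := CStarMatrix.toEuclidean.comp (ConvAlg.orbitHom hx hr)
  norm_le f := (CStarMatrix.norm_toEuclidean _).trans_le (f.norm_orbitMatrix_le hx hm)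

theorem GroupoidRep.norm_hom_le (ρ : GroupoidRep r) (f : ConvAlg r) :
    ‖ρ.hom f‖ ≤ ‖toGroupoidCStar r f‖ :=
  lp.norm_apply_le_norm ENNReal.top_ne_zero
    (show lp (fun ρ : GroupoidRep r => ρ.H →L[ℂ] ρ.H) ∞ from universalRep r f) ρ

theorem norm_toGroupoidCStar_le_iNorm (f : ConvAlg r) (h0 : 0 ≤ f.iNorm) :
    ‖toGroupoidCStar r f‖ ≤ f.iNorm :=
  lp.norm_le_of_forall_le (f := show lp (fun ρ : GroupoidRep r => ρ.H →L[ℂ] ρ.H) ∞ from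
    universalRep r f) h0 fun ρ => ρ.norm_le f

/-- Restriction to a finite invariant set is among the representations over which the full norm is a
supremum. -/
theorem norm_orbitMatrix_le_norm_toGroupoidCStar {n : Type*} [Fintype n] [DecidableEq n]
    [Small.{u} n] {x : n → X}
    (hx : Function.Injective x) (hr : ∀ i y, r (x i) y → y ∈ range x) {m : ℕ}
    (hm : ∀ x, ∃ S : Finset X, S.card ≤ m ∧ ∀ y, r x y → y ∈ S) (f : ConvAlg r) :
    ‖f.orbitMatrix x‖ ≤ ‖toGroupoidCStar r f‖ := by
  classical
  -- The Hilbert space of a `GroupoidRep` lives in the universe of `X`, so the index type is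
  -- replaced by a copy there; reindexing matrices is isometric.
  let e : Shrink.{u} n ≃ n := (equivShrink n).symm
  have : Fintype (Shrink.{u} n) := Fintype.ofEquiv n e.symm
  have hx' : Function.Injective (x ∘ e) := hx.comp e.injective
  have hr' : ∀ i y, r ((x ∘ e) i) y → y ∈ range (x ∘ e) := fun i y h => by
    rw [e.surjective.range_comp]
    exact hr _ y h
  have h1 := (orbitRep hx' hr' hm).norm_hom_le f
  have h2 : ‖CStarMatrix.toEuclidean (f.orbitMatrix (x ∘ e))‖ ≤ ‖toGroupoidCStar r f‖ := h1
  rw [CStarMatrix.norm_toEuclidean] at h2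
  have h3 := StarAlgEquiv.norm_map (CStarMatrix.reindexₐ ℂ ℂ e) (f.orbitMatrix (x ∘ e))
  have h4 : CStarMatrix.reindexₐ ℂ ℂ e (f.orbitMatrix (x ∘ e)) = f.orbitMatrix x := by
    ext i j
    change f.kernel (x (e (e.symm i))) (x (e (e.symm j))) = f.kernel (x i) (x j)
    simp
  rwa [← h4, h3]

theorem denseRange_toGroupoidCStar : DenseRange (toGroupoidCStar r) := by
  rintro ⟨x, hx⟩
  have hx' : x ∈ closure (range (universalRep r)) := hx
  have h : (Subtype.val : ↥(groupoidCStarSubalgebra r) → RepProduct r) ''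
      range (toGroupoidCStar r) = range (universalRep r) :=
    (range_comp Subtype.val (toGroupoidCStar r)).symm
  rw [← h] at hx'
  exact closure_subtype.2 hx'

end FiniteOrbits

/-! ## The groupoid of a gluing -/

/-- The inclusion of the unit space in the groupoid of a relation. -/
def unitMap {X : Type u} (r : Setoid X) (x : X) : RelGroupoid r := ⟨(x, x), r.refl x⟩

theorem isClosedEmbedding_unitMap {X : Type u} [TopologicalSpace X] [T2Space X] (r : Setoid X) :
    IsClosedEmbedding (unitMap r) := by
  have hc : Continuous (unitMap r) := by unfold unitMap; fun_prop
  refine ⟨IsEmbedding.of_comp hc (g := fun γ : RelGroupoid r => γ.1.1) (by fun_prop)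
    IsEmbedding.id, ?_⟩
  have : range (unitMap r) = {γ : RelGroupoid r | γ.1.1 = γ.1.2} := by
    ext ⟨⟨x, y⟩, h⟩
    constructor
    · rintro ⟨z, hz⟩
      have h1 : z = x := congrArg (fun γ : RelGroupoid r => γ.1.1) hz
      have h2 : z = y := congrArg (fun γ : RelGroupoid r => γ.1.2) hz
      exact h1.symm.trans h2
    · intro hxy
      obtain rfl : x = y := hxy
      exact ⟨x, rfl⟩
  rw [this]
  exact isClosed_eq (by fun_prop) (by fun_prop)

/-- The restriction of a function on the groupoid along a closed embedding. -/
noncomputable def ConvAlg.compClosedEmbedding {X : Type u} {Y : Type*} [TopologicalSpace X]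
    [TopologicalSpace Y] {r : Setoid X} (h : ConvAlg r) {c : Y → RelGroupoid r}
    (hc : IsClosedEmbedding c) : C₀(Y, ℂ) where
  toFun y := h.toFun (c y)
  continuous_toFun := h.toFun_continuous.comp hc.continuous
  zero_at_infty' := h.toFun_hasCompactSupport.is_zero_at_infty.comp hc.tendsto_cocompact

namespace Gluing

variable {k : ℕ} {N : Type u} {MQ : Type v} {R : Type w}
  [TopologicalSpace N] [TopologicalSpace MQ] [TopologicalSpace R] (D : Gluing k N MQ R)

theorem inclP_inj {i j : Fin k} {p p' : R} (h : D.inclP (i, p) = D.inclP (j, p')) :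
    i = j ∧ p = p' :=
  Prod.mk.inj (D.isClosedEmbedding_inclP.injective h)

theorem eq_of_rel_inclQ {q : MQ} {y : N} (h : D.rel (D.inclQ q) y) : y = D.inclQ q := by
  rcases h with h | ⟨p, hp, i, j, hi, _⟩
  · exact h.symm
  · exact absurd ⟨q, hi.symm⟩ (D.inclP_notMem_range hp)

theorem exists_eq_of_rel_inclP {i : Fin k} {p : R} {y : N} (h : D.rel (D.inclP (i, p)) y) :
    ∃ j, y = D.inclP (j, p) := by
  rcases h with h | ⟨p', _, i', j, hi, hj⟩
  · exact ⟨i, h.symm⟩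
  · obtain ⟨_, rfl⟩ := D.inclP_inj hi
    exact ⟨j, hj.symm⟩

theorem rel_inclP_of_notMem {p : R} (hp : p ∉ D.sigmaR) (i j : Fin k) :
    D.rel (D.inclP (i, p)) (D.inclP (j, p)) :=
  Or.inr ⟨p, hp, i, j, rfl, rfl⟩

theorem eq_of_rel_inclP {p : R} (hp : p ∈ D.sigmaR) {i j : Fin k}
    (h : D.rel (D.inclP (i, p)) (D.inclP (j, p))) : i = j := by
  rw [← D.glue i ⟨p, hp⟩] at h
  have := D.eq_of_rel_inclQ h
  rw [D.glue i ⟨p, hp⟩] at this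
  exact (D.inclP_inj this).1.symm

theorem exists_inclQ_or_inclP (x : N) : (∃ q, x = D.inclQ q) ∨ ∃ i p, x = D.inclP (i, p) := by
  have : x ∈ range D.inclQ ∪ range D.inclP := D.cover ▸ mem_univ x
  rcases this with ⟨q, rfl⟩ | ⟨⟨i, p⟩, rfl⟩
  · exact Or.inl ⟨q, rfl⟩
  · exact Or.inr ⟨i, p, rfl⟩

/-- The bound is `k + 1` and not `k` in order to cover the one-point orbits of `M^Q` when `k = 0`.
-/
theorem exists_finset_rel (x : N) :
    ∃ S : Finset N, S.card ≤ k + 1 ∧ ∀ y, D.rel x y → y ∈ S := by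
  classical
  rcases D.exists_inclQ_or_inclP x with ⟨q, rfl⟩ | ⟨i, p, rfl⟩
  · exact ⟨{D.inclQ q}, by simp, fun y hy => by simpa using D.eq_of_rel_inclQ hy⟩
  · refine ⟨Finset.univ.image fun j => D.inclP (j, p),
      Finset.card_image_le.trans (by simp), fun y hy => ?_⟩
    obtain ⟨j, rfl⟩ := D.exists_eq_of_rel_inclP hy
    simp

theorem isClosedEmbedding_sheet (i : Fin k) : IsClosedEmbedding fun p => D.inclP (i, p) := by
  refine D.isClosedEmbedding_inclP.comp ?_
  refine ⟨IsEmbedding.of_comp (by fun_prop) continuous_snd IsEmbedding.id, ?_⟩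
  have : (range fun p : R => (i, p)) = {i} ×ˢ univ := by
    ext ⟨j, p⟩
    simp [eq_comm]
  rw [this]
  exact (isClosed_discrete _).prod isClosed_univ

/-- The elements of the groupoid joining two different sheets of `M^P`. -/
def sheetPair (i j : Fin k) (p : ↥D.sigmaRᶜ) : RelGroupoid D.rel :=
  ⟨(D.inclP (i, p), D.inclP (j, p)), D.rel_inclP_of_notMem p.2 i j⟩

/-- The image is closed in the groupoid although `R - Σ_R` need not be closed in `R`: over a point
of `Σ_R` different sheets are inequivalent, so the missing limit pairs lie outside the groupoid.
Hence an off-diagonal entry of `h` vanishes at infinity on `R - Σ_R`, in particular towards `Σ_R`.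
-/
theorem isClosedEmbedding_sheetPair {i j : Fin k} (hij : i ≠ j) :
    IsClosedEmbedding (D.sheetPair i j) := by
  have hci := (D.isClosedEmbedding_sheet i).continuous
  have hcj := (D.isClosedEmbedding_sheet j).continuous
  have hc : Continuous (D.sheetPair i j) :=
    ((hci.comp continuous_subtype_val).prodMk (hcj.comp continuous_subtype_val)).subtype_mk _
  refine ⟨IsEmbedding.of_comp hc (g := fun γ : RelGroupoid D.rel => γ.1.1) (by fun_prop)
    ((D.isClosedEmbedding_sheet i).isEmbedding.comp IsEmbedding.subtypeVal), ?_⟩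
  have : range (D.sheetPair i j) = {γ : RelGroupoid D.rel |
      γ.1.1 ∈ (range fun p => D.inclP (i, p)) ∧ γ.1.2 ∈ (range fun p => D.inclP (j, p))} := by
    ext ⟨⟨x, y⟩, h⟩
    constructor
    · rintro ⟨p, hp⟩
      rw [← hp]
      exact ⟨⟨p, rfl⟩, ⟨p, rfl⟩⟩
    · rintro ⟨⟨p, rfl⟩, ⟨p', rfl⟩⟩
      obtain ⟨j', hj'⟩ := D.exists_eq_of_rel_inclP h
      obtain ⟨rfl, rfl⟩ := D.inclP_inj hj'
      exact ⟨⟨p', fun hp => hij (D.eq_of_rel_inclP hp h)⟩, rfl⟩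
  rw [this]
  exact ((D.isClosedEmbedding_sheet i).isClosed_range.preimage (by fun_prop)).inter
    ((D.isClosedEmbedding_sheet j).isClosed_range.preimage (by fun_prop))

theorem kernel_sheet_of_mem (h : ConvAlg D.rel) {p : R} (hp : p ∈ D.sigmaR) (i j : Fin k) :
    h.kernel (D.inclP (i, p)) (D.inclP (j, p)) =
      if i = j then h.kernel (D.inclQ (D.attach i ⟨p, hp⟩)) (D.inclQ (D.attach i ⟨p, hp⟩))
      else 0 := by
  split_ifs with hij
  · subst hij
    rw [D.glue i ⟨p, hp⟩]
  · exact h.kernel_of_not_rel fun hr => hij (D.eq_of_rel_inclP hp hr)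

theorem injective_sheets (p : R) : Function.Injective fun i : Fin k => D.inclP (i, p) :=
  fun _ _ h => (D.inclP_inj h).1

theorem mem_range_of_rel_sheet (p : R) (i : Fin k) (y : N) (h : D.rel (D.inclP (i, p)) y) :
    y ∈ range fun j : Fin k => D.inclP (j, p) := by
  obtain ⟨j, rfl⟩ := D.exists_eq_of_rel_inclP h
  exact ⟨j, rfl⟩

/-- A pair in `A` defines a function on the groupoid. -/
theorem exists_groupoidFunction {a : C₀(MQ, ℂ) × C₀(R, CStarMatrix (Fin k) (Fin k) ℂ)}
    (ha : a ∈ D.pairAlgebra) : ∃ K : RelGroupoid D.rel → ℂ,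
      (∀ q, K (unitMap D.rel (D.inclQ q)) = a.1 q) ∧
      ∀ (p : R) (i j : Fin k) (h : D.rel (D.inclP (i, p)) (D.inclP (j, p))),
        K ⟨(D.inclP (i, p), D.inclP (j, p)), h⟩ = a.2 p i j := by
  -- A unit in `Σ` is seen both from `M^Q` and from `M^P`; the condition that defines `A` makes the
  -- two prescribed values agree.
  have key : ∀ γ : RelGroupoid D.rel, ∃ z : ℂ, (∀ q, γ = unitMap D.rel (D.inclQ q) → z = a.1 q) ∧
      ∀ p i j, γ.1 = (D.inclP (i, p), D.inclP (j, p)) → z = a.2 p i j := by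
    rintro ⟨⟨x, y⟩, hxy⟩
    rcases D.exists_inclQ_or_inclP x with ⟨q, rfl⟩ | ⟨i, p, rfl⟩
    · obtain rfl := D.eq_of_rel_inclQ hxy
      refine ⟨a.1 q, fun q' hq' => ?_, fun p i j hp => ?_⟩
      · have : D.inclQ q = D.inclQ q' := congrArg (fun γ : RelGroupoid D.rel => γ.1.1) hq'
        rw [D.isClosedEmbedding_inclQ.injective this]
      · obtain ⟨h1, h2⟩ := Prod.mk.inj hp
        have hps := D.inter q i p h1
        obtain ⟨rfl, _⟩ := D.inclP_inj (h1.symm.trans h2)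
        have hq : q = D.attach i ⟨p, hps⟩ :=
          D.isClosedEmbedding_inclQ.injective (h1.trans (D.glue i ⟨p, hps⟩).symm)
        have := congrFun (congrFun (ha ⟨p, hps⟩) i) i
        rw [this, CStarMatrix.ofMatrix_apply, Matrix.diagonal_apply_eq, hq]
    · obtain ⟨j, rfl⟩ := D.exists_eq_of_rel_inclP hxy
      refine ⟨a.2 p i j, fun q hq => ?_, fun p' i' j' hp => ?_⟩
      · have h1 : D.inclP (i, p) = D.inclQ q := congrArg (fun γ : RelGroupoid D.rel => γ.1.1) hq
        have h2 : D.inclP (j, p) = D.inclQ q := congrArg (fun γ : RelGroupoid D.rel => γ.1.2) hq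
        have hps := D.inter q i p h1.symm
        obtain ⟨rfl, _⟩ := D.inclP_inj (h1.trans h2.symm)
        have hq : q = D.attach i ⟨p, hps⟩ :=
          D.isClosedEmbedding_inclQ.injective (h1.symm.trans (D.glue i ⟨p, hps⟩).symm)
        have := congrFun (congrFun (ha ⟨p, hps⟩) i) i
        rw [this, CStarMatrix.ofMatrix_apply, Matrix.diagonal_apply_eq, hq]
      · obtain ⟨h1, h2⟩ := Prod.mk.inj hp
        obtain ⟨rfl, rfl⟩ := D.inclP_inj h1
        obtain ⟨rfl, _⟩ := D.inclP_inj h2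
        rfl
  choose K hK1 hK2 using key
  exact ⟨K, fun q => hK1 _ q rfl, fun p i j h => hK2 _ p i j rfl⟩

/-- The groupoid is a finite union of closed pieces, on each of which `K` is a component of `a`.
With `S` closed this yields continuity of `K`, and with `S = {z | ε ≤ ‖z‖}` it yields compactness.
-/
theorem preimage_groupoidFunction {a : C₀(MQ, ℂ) × C₀(R, CStarMatrix (Fin k) (Fin k) ℂ)}
    {K : RelGroupoid D.rel → ℂ} (hK1 : ∀ q, K (unitMap D.rel (D.inclQ q)) = a.1 q)
    (hK2 : ∀ (p : R) (i j : Fin k) (h : D.rel (D.inclP (i, p)) (D.inclP (j, p))),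
        K ⟨(D.inclP (i, p), D.inclP (j, p)), h⟩ = a.2 p i j) (S : Set ℂ) :
    K ⁻¹' S = (fun q => unitMap D.rel (D.inclQ q)) '' {q | a.1 q ∈ S} ∪
      ((⋃ i, (fun p => unitMap D.rel (D.inclP (i, p))) '' {p | a.2 p i i ∈ S}) ∪
      ⋃ i, ⋃ j, ⋃ _ : i ≠ j, D.sheetPair i j '' {p | a.2 (p : R) i j ∈ S}) := by
  ext γ
  constructor
  · intro hγ
    obtain ⟨⟨x, y⟩, hxy⟩ := γ
    have hγ : K ⟨(x, y), hxy⟩ ∈ S := hγ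
    rcases D.exists_inclQ_or_inclP x with ⟨q, rfl⟩ | ⟨i, p, rfl⟩
    · obtain rfl := D.eq_of_rel_inclQ hxy
      refine Or.inl ⟨q, ?_, rfl⟩
      rw [mem_ofPred_eq, ← hK1]
      exact hγ
    · obtain ⟨j, rfl⟩ := D.exists_eq_of_rel_inclP hxy
      rw [hK2] at hγ
      by_cases hij : i = j
      · subst hij
        exact Or.inr (Or.inl (mem_iUnion.2 ⟨i, p, hγ, rfl⟩))
      · exact Or.inr (Or.inr (mem_iUnion₂.2 ⟨i, j, mem_iUnion.2
          ⟨hij, ⟨p, fun hp => hij (D.eq_of_rel_inclP hp hxy)⟩, hγ, rfl⟩⟩))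
  · rintro (⟨q, hq, rfl⟩ | hγ | hγ)
    · rw [mem_preimage, hK1]
      exact hq
    · obtain ⟨i, p, hp, rfl⟩ := mem_iUnion.1 hγ
      have e : K (unitMap D.rel (D.inclP (i, p))) = a.2 p i i := hK2 p i i _
      rw [mem_preimage, e]
      exact hp
    · obtain ⟨i, j, hγ⟩ := mem_iUnion₂.1 hγ
      obtain ⟨_, p, hp, rfl⟩ := mem_iUnion.1 hγ
      rw [mem_preimage, sheetPair, hK2]
      exact hp

/-! ### The pair of functions of an element of the convolution algebra -/

variable [T2Space N]

theorem isClosedEmbedding_unitQ : IsClosedEmbedding fun q => unitMap D.rel (D.inclQ q) :=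
  (isClosedEmbedding_unitMap D.rel).comp D.isClosedEmbedding_inclQ

theorem isClosedEmbedding_unitP (i : Fin k) :
    IsClosedEmbedding fun p => unitMap D.rel (D.inclP (i, p)) :=
  (isClosedEmbedding_unitMap D.rel).comp (D.isClosedEmbedding_sheet i)

theorem kernel_mul_inclQ (f g : ConvAlg D.rel) (q : MQ) :
    (f * g).kernel (D.inclQ q) (D.inclQ q) =
      f.kernel (D.inclQ q) (D.inclQ q) * g.kernel (D.inclQ q) (D.inclQ q) := by
  rw [ConvAlg.kernel_mul_eq_sum f g _ _ {D.inclQ q} fun y hy => by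
    simpa using D.eq_of_rel_inclQ (ConvAlg.rel_of_kernel_ne_zero hy), Finset.sum_singleton]

/-- A diagonal entry is a restriction of `h` along a closed embedding of `R`. An off-diagonal entry
is one along a closed embedding of the open set `R - Σ_R`, and so extends by zero. -/
theorem exists_sheetEntry (h : ConvAlg D.rel) (i j : Fin k) :
    ∃ F : C₀(R, ℂ), ∀ p, F p = h.kernel (D.inclP (i, p)) (D.inclP (j, p)) := by
  by_cases hij : i = j
  · subst hij
    exact ⟨h.compClosedEmbedding (D.isClosedEmbedding_unitP i),
      fun p => (h.kernel_of_rel (D.rel.refl _)).symm⟩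
  · have : T2Space R := (D.isClosedEmbedding_sheet i).isEmbedding.t2Space
    have hU := (D.isClosed_sigmaR_of i).isOpen_compl
    let F := h.compClosedEmbedding (D.isClosedEmbedding_sheetPair hij)
    refine ⟨F.extendZero hU, fun p => ?_⟩
    by_cases hp : p ∈ D.sigmaR
    · rw [F.extendZero_of_notMem hU (fun h' => h' hp), D.kernel_sheet_of_mem h hp, if_neg hij]
    · rw [F.extendZero_apply hU ⟨p, hp⟩, h.kernel_of_rel (D.rel_inclP_of_notMem hp i j)]
      rfl

/-- The pair `(f_h, g_h)` of functions defined by `h ∈ C_c(𝒢)`. -/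
noncomputable def pairMap (h : ConvAlg D.rel) :
    C₀(MQ, ℂ) × C₀(R, CStarMatrix (Fin k) (Fin k) ℂ) :=
  (h.compClosedEmbedding D.isClosedEmbedding_unitQ,
    .ofEntries fun i j => (D.exists_sheetEntry h i j).choose)

theorem pairMap_fst_apply (h : ConvAlg D.rel) (q : MQ) :
    (D.pairMap h).1 q = h.kernel (D.inclQ q) (D.inclQ q) :=
  (h.kernel_of_rel (D.rel.refl _)).symm

theorem pairMap_snd_apply (h : ConvAlg D.rel) (p : R) :
    (D.pairMap h).2 p = h.orbitMatrix fun i => D.inclP (i, p) :=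
  CStarMatrix.ext fun i j => (D.exists_sheetEntry h i j).choose_spec p

theorem pairMap_snd_apply_apply (h : ConvAlg D.rel) (p : R) (i j : Fin k) :
    (D.pairMap h).2 p i j = h.kernel (D.inclP (i, p)) (D.inclP (j, p)) :=
  (D.exists_sheetEntry h i j).choose_spec p

theorem pairMap_mul_fst (h h' : ConvAlg D.rel) (q : MQ) :
    (D.pairMap (h * h')).1 q = (D.pairMap h).1 q * (D.pairMap h').1 q := by
  simp only [pairMap_fst_apply, kernel_mul_inclQ]

theorem pairMap_mul_snd (h h' : ConvAlg D.rel) (p : R) :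
    (D.pairMap (h * h')).2 p = (D.pairMap h).2 p * (D.pairMap h').2 p := by
  simp only [pairMap_snd_apply]
  exact ConvAlg.orbitMatrix_mul (D.injective_sheets p) (D.mem_range_of_rel_sheet p) h h'

theorem pairMap_star_fst (h : ConvAlg D.rel) (q : MQ) :
    (D.pairMap (star h)).1 q = star ((D.pairMap h).1 q) := by
  simp only [pairMap_fst_apply, ConvAlg.kernel_star]

theorem pairMap_star_snd (h : ConvAlg D.rel) (p : R) :
    (D.pairMap (star h)).2 p = star ((D.pairMap h).2 p) := by
  simp only [pairMap_snd_apply, ConvAlg.orbitMatrix_star]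

theorem pairMap_mem (h : ConvAlg D.rel) : D.pairMap h ∈ D.pairAlgebra := by
  intro p
  ext i j
  rw [pairMap_snd_apply_apply, D.kernel_sheet_of_mem h p.2, CStarMatrix.ofMatrix_apply,
    Matrix.diagonal_apply, pairMap_fst_apply]

theorem norm_pairMap_star_mul_self (h : ConvAlg D.rel) :
    ‖D.pairMap (star h * h)‖ = ‖D.pairMap h‖ ^ 2 := by
  have h1 : ‖(D.pairMap (star h * h)).1‖ = ‖(D.pairMap h).1‖ ^ 2 := by
    refine ZeroAtInftyContinuousMap.norm_eq_norm_sq _ _ fun q => ?_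
    rw [pairMap_mul_fst, pairMap_star_fst, CStarRing.norm_star_mul_self, sq]
  have h2 : ‖(D.pairMap (star h * h)).2‖ = ‖(D.pairMap h).2‖ ^ 2 := by
    refine ZeroAtInftyContinuousMap.norm_eq_norm_sq _ _ fun p => ?_
    rw [pairMap_mul_snd, pairMap_star_snd, sq]
    exact CStarRing.norm_star_mul_self
  rw [Prod.norm_def, Prod.norm_def, h1, h2]
  exact max_sq_of_nonneg (norm_nonneg (D.pairMap h).1) (norm_nonneg (D.pairMap h).2)

theorem norm_pairMap_nonneg (h : ConvAlg D.rel) : 0 ≤ ‖D.pairMap h‖ :=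
  le_max_of_le_left (norm_nonneg (D.pairMap h).1)

theorem norm_kernel_le_norm_pairMap (h : ConvAlg D.rel) (x y : N) :
    ‖h.kernel x y‖ ≤ ‖D.pairMap h‖ := by
  by_cases hr : D.rel x y
  · rcases D.exists_inclQ_or_inclP x with ⟨q, rfl⟩ | ⟨i, p, rfl⟩
    · obtain rfl := D.eq_of_rel_inclQ hr
      rw [← pairMap_fst_apply]
      exact ((D.pairMap h).1.norm_apply_le q).trans (norm_fst_le _)
    · obtain ⟨j, rfl⟩ := D.exists_eq_of_rel_inclP hr
      rw [← pairMap_snd_apply_apply]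
      exact (CStarMatrix.norm_entry_le_norm.trans ((D.pairMap h).2.norm_apply_le p)).trans
        (norm_snd_le _)
  · rw [h.kernel_of_not_rel hr, norm_zero]
    exact D.norm_pairMap_nonneg h

/-- For `≤`, the values at `q` and at `p` are restrictions to the invariant sets `{q}` and `{p_1, …,
p_k}`. For `≥`, the `I`-norm gives the estimate up to the factor `k + 1`, and the C*-identities
remove this factor. -/
theorem norm_pairMap (h : ConvAlg D.rel) : ‖D.pairMap h‖ = ‖toGroupoidCStar D.rel h‖ := by
  refine le_antisymm ?_ ?_
  · refine max_le ?_ ?_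
    · refine (ZeroAtInftyContinuousMap.norm_le_iff _ (norm_nonneg _)).2 fun q => ?_
      rw [pairMap_fst_apply]
      refine le_trans ?_ (norm_orbitMatrix_le_norm_toGroupoidCStar (r := D.rel)
        (x := fun _ : Unit => D.inclQ q) (fun _ _ _ => rfl)
        (fun _ y hy => ⟨(), (D.eq_of_rel_inclQ hy).symm⟩) D.exists_finset_rel h)
      exact CStarMatrix.norm_entry_le_norm (M := h.orbitMatrix fun _ : Unit => D.inclQ q)
        (i := ()) (j := ())
    · refine (ZeroAtInftyContinuousMap.norm_le_iff _ (norm_nonneg _)).2 fun p => ?_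
      rw [pairMap_snd_apply]
      exact norm_orbitMatrix_le_norm_toGroupoidCStar (D.injective_sheets p)
        (D.mem_range_of_rel_sheet p) D.exists_finset_rel h
  · refine le_of_le_mul_of_cstar (p := fun b => ‖D.pairMap b‖)
      (q := fun b => ‖toGroupoidCStar D.rel b‖) D.norm_pairMap_nonneg (fun _ => norm_nonneg _)
      D.norm_pairMap_star_mul_self (fun b => ?_) ((k + 1 : ℕ) : ℝ) (fun b => ?_) h
    · rw [map_mul, map_star, CStarRing.norm_star_mul_self, sq]
    · have h0 : 0 ≤ b.iNorm :=
        le_max_of_le_left (Real.iSup_nonneg fun x => finsum_nonneg fun y => norm_nonneg _)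
      exact (norm_toGroupoidCStar_le_iNorm b h0).trans
        (b.iNorm_le D.exists_finset_rel (D.norm_pairMap_nonneg b) (D.norm_kernel_le_norm_pairMap b))

/-- The soft threshold of `K` has compact support and moves each value by at most `ε`. A `k × k`
matrix with entries of size at most `ε` has norm at most `k * ε`, and the term `+ 1` covers the
scalar component. -/
theorem exists_norm_pairMap_sub_le {a : C₀(MQ, ℂ) × C₀(R, CStarMatrix (Fin k) (Fin k) ℂ)}
    (ha : a ∈ D.pairAlgebra) {ε : ℝ} (hε : 0 < ε) :
    ∃ h : ConvAlg D.rel, ‖D.pairMap h - a‖ ≤ (k + 1) * ε := by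
  obtain ⟨K, hK1, hK2⟩ := D.exists_groupoidFunction ha
  have hpre := D.preimage_groupoidFunction hK1 hK2
  have hcont : Continuous K := by
    refine continuous_iff_isClosed.2 fun S hS => ?_
    rw [hpre S]
    refine IsClosed.union ?_ (IsClosed.union ?_ ?_)
    · exact D.isClosedEmbedding_unitQ.isClosedMap _ (hS.preimage a.1.continuous)
    · exact isClosed_iUnion_of_finite fun i => (D.isClosedEmbedding_unitP i).isClosedMap _
        (hS.preimage (a.2.entry i i).continuous)
    · exact isClosed_iUnion_of_finite fun i => isClosed_iUnion_of_finite fun j =>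
        isClosed_iUnion_of_finite fun hij => (D.isClosedEmbedding_sheetPair hij).isClosedMap _
          (hS.preimage ((a.2.entry i j).continuous.comp continuous_subtype_val))
  have hcomp : IsCompact (K ⁻¹' {z | ε ≤ ‖z‖}) := by
    rw [hpre]
    refine IsCompact.union ?_ (IsCompact.union ?_ ?_)
    · exact (a.1.isCompact_setOf_le_norm hε).image D.isClosedEmbedding_unitQ.continuous
    · exact isCompact_iUnion fun i => ((a.2.entry i i).isCompact_setOf_le_norm hε).image
        (D.isClosedEmbedding_unitP i).continuous
    · refine isCompact_iUnion fun i => isCompact_iUnion fun j => isCompact_iUnion fun hij => ?_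
      -- The off-diagonal entry vanishes on `Σ_R`, so `{ε ≤ ‖·‖}` is compact already in `R - Σ_R`,
      -- where `sheetPair` is defined.
      have h0 : ∀ p ∉ D.sigmaRᶜ, a.2.entry i j p = 0 := fun p hp => by
        have hp' : p ∈ D.sigmaR := not_not.1 hp
        have := congrFun (congrFun (ha ⟨p, hp'⟩) i) j
        exact this.trans (Matrix.diagonal_apply_ne _ hij)
      exact (((a.2.entry i j).restrictOfEqZero h0).isCompact_setOf_le_norm hε).image
        (D.isClosedEmbedding_sheetPair hij).continuous
  let h : ConvAlg D.rel := .mk (fun γ => softThreshold ε (K γ))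
    ((continuous_softThreshold hε).comp hcont)
    (HasCompactSupport.intro hcomp fun γ hγ => softThreshold_eq_zero hε (not_le.1 hγ).le)
  refine ⟨h, max_le ?_ ?_⟩
  · refine (ZeroAtInftyContinuousMap.norm_le_iff _ (by positivity)).2 fun q => ?_
    have h1 : ((D.pairMap h).1 - a.1) q = softThreshold ε (a.1 q) - a.1 q := by
      have h2 : (D.pairMap h).1 q = softThreshold ε (K (unitMap D.rel (D.inclQ q))) := rfl
      change (D.pairMap h).1 q - a.1 q = _
      rw [h2, hK1]
    refine (h1 ▸ norm_softThreshold_sub_le hε _).trans ?_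
    nlinarith [(Nat.cast_nonneg k : (0 : ℝ) ≤ k)]
  · refine (ZeroAtInftyContinuousMap.norm_le_iff _ (by positivity)).2 fun p => ?_
    refine (CStarMatrix.norm_le_card_mul _ hε.le fun i j => ?_).trans
      (by rw [Fintype.card_fin]; nlinarith)
    change ‖(D.pairMap h).2 p i j - a.2 p i j‖ ≤ ε
    rw [pairMap_snd_apply_apply]
    by_cases hr : D.rel (D.inclP (i, p)) (D.inclP (j, p))
    · rw [h.kernel_of_rel hr, ← hK2 p i j hr]
      exact norm_softThreshold_sub_le hε _
    · rw [h.kernel_of_not_rel hr]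
      have hij : i ≠ j := fun hij => hr (hij ▸ D.rel.refl _)
      have hp : p ∈ D.sigmaR := by
        by_contra hp
        exact hr (D.rel_inclP_of_notMem hp i j)
      have h0 : a.2 p i j = 0 :=
        (congrFun (congrFun (ha ⟨p, hp⟩) i) j).trans (Matrix.diagonal_apply_ne _ hij)
      rw [h0, sub_zero, norm_zero]
      exact hε.le

end Gluing

/-! ### The isomorphism of the groupoid C*-algebra with `A` -/

namespace Gluing

variable {k : ℕ} {N : Type u} {MQ : Type v} {R : Type w}
  [TopologicalSpace N] [TopologicalSpace MQ] [TopologicalSpace R] (D : Gluing k N MQ R)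

theorem mem_pairAlgebra_iff {a : C₀(MQ, ℂ) × C₀(R, CStarMatrix (Fin k) (Fin k) ℂ)} :
    a ∈ D.pairAlgebra ↔ ∀ (p : D.sigmaR) (i j : Fin k),
      a.2 (p : R) i j = if i = j then a.1 (D.attach i p) else 0 := by
  constructor
  · intro ha p i j
    rw [ha p, CStarMatrix.ofMatrix_apply, Matrix.diagonal_apply]
  · intro ha p
    ext i j
    rw [ha p, CStarMatrix.ofMatrix_apply, Matrix.diagonal_apply]

theorem continuous_fst_apply (q : MQ) :
    Continuous fun a : C₀(MQ, ℂ) × C₀(R, CStarMatrix (Fin k) (Fin k) ℂ) => a.1 q :=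
  (ZeroAtInftyContinuousMap.continuous_apply q).comp continuous_fst

theorem continuous_snd_apply (p : R) :
    Continuous fun a : C₀(MQ, ℂ) × C₀(R, CStarMatrix (Fin k) (Fin k) ℂ) => a.2 p :=
  (ZeroAtInftyContinuousMap.continuous_apply p).comp continuous_snd

theorem continuous_snd_apply_apply (p : R) (i j : Fin k) :
    Continuous fun a : C₀(MQ, ℂ) × C₀(R, CStarMatrix (Fin k) (Fin k) ℂ) => a.2 p i j :=
  (continuous_apply_apply i j).comp (continuous_snd_apply p)

theorem isClosed_pairAlgebra : IsClosed
    {a : C₀(MQ, ℂ) × C₀(R, CStarMatrix (Fin k) (Fin k) ℂ) | a ∈ D.pairAlgebra} := by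
  simp only [mem_pairAlgebra_iff, ofPred_forall]
  refine isClosed_iInter fun p => isClosed_iInter fun i => isClosed_iInter fun j =>
    isClosed_eq (continuous_snd_apply_apply _ i j) ?_
  split_ifs
  · exact continuous_fst_apply _
  · exact continuous_const

variable [T2Space N]

theorem closure_range_pairMap :
    closure (range D.pairMap) = {a | a ∈ D.pairAlgebra} := by
  refine Subset.antisymm (closure_minimal ?_ D.isClosed_pairAlgebra) fun a ha => ?_
  · rintro _ ⟨h, rfl⟩
    exact D.pairMap_mem h
  · refine (Metric.mem_closure_iff (α := C₀(MQ, ℂ) × C₀(R, CStarMatrix (Fin k) (Fin k) ℂ))).2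
      fun ε hε => ?_
    obtain ⟨h, hh⟩ := D.exists_norm_pairMap_sub_le ha
      (show 0 < ε / (2 * (k + 1)) by positivity)
    refine ⟨_, ⟨h, rfl⟩, ?_⟩
    have hd : dist a (D.pairMap h) = ‖D.pairMap h - a‖ :=
      (dist_comm _ _).trans (dist_eq_norm (D.pairMap h) a)
    refine hd.trans_lt (hh.trans_lt ?_)
    field_simp
    linarith

set_option synthInstance.maxHeartbeats 200000 in
theorem exists_starAlgEquiv : ∃ Φ : GroupoidCStar D.rel ≃⋆ₐ[ℂ] D.pairAlgebra,
    ∀ h, (Φ (toGroupoidCStar D.rel h)).1 = D.pairMap h := by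
  have hj := denseRange_toGroupoidCStar (r := D.rel)
  obtain ⟨Ψ, hΨ, hrange⟩ := exists_linearIsometry_of_norm_eq
    (F := C₀(MQ, ℂ) × C₀(R, CStarMatrix (Fin k) (Fin k) ℂ))
    (toGroupoidCStar D.rel : ConvAlg D.rel →ₗ[ℂ] GroupoidCStar D.rel) D.pairMap
    (fun h h' => by
      refine Prod.ext (ZeroAtInftyContinuousMap.ext fun q => ?_)
        (ZeroAtInftyContinuousMap.ext fun p => CStarMatrix.ext fun i j => ?_)
      · change _ = (D.pairMap h).1 q + (D.pairMap h').1 q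
        simp only [pairMap_fst_apply, ConvAlg.kernel_add]
      · change _ = (D.pairMap h).2 p i j + (D.pairMap h').2 p i j
        simp only [pairMap_snd_apply_apply, ConvAlg.kernel_add])
    (fun c h => by
      refine Prod.ext (ZeroAtInftyContinuousMap.ext fun q => ?_)
        (ZeroAtInftyContinuousMap.ext fun p => CStarMatrix.ext fun i j => ?_)
      · change _ = c * (D.pairMap h).1 q
        simp only [pairMap_fst_apply, ConvAlg.kernel_smul]
      · change _ = c * (D.pairMap h).2 p i j
        simp only [pairMap_snd_apply_apply, ConvAlg.kernel_smul])
    hj D.norm_pairMap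
  have hΨ' : ∀ h, Ψ (toGroupoidCStar D.rel h) = D.pairMap h := hΨ
  have hrange' : range Ψ = {a | a ∈ D.pairAlgebra} := hrange.trans D.closure_range_pairMap
  -- After evaluation at a point both sides are continuous in `x` and `y`, so it suffices to compare
  -- them on the dense image of the convolution algebra. The same argument serves for the
  -- involution.
  have hmul : ∀ x y, Ψ (x * y) = Ψ x * Ψ y := by
    intro x y
    refine Prod.ext (ZeroAtInftyContinuousMap.ext fun q => ?_)
      (ZeroAtInftyContinuousMap.ext fun p => ?_)
    · change _ = (Ψ x).1 q * (Ψ y).1 q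
      have hc := (continuous_fst_apply (k := k) (R := R) q).comp Ψ.continuous
      exact hj.induction_on₂ (p := fun x y => (Ψ (x * y)).1 q = (Ψ x).1 q * (Ψ y).1 q)
        (isClosed_eq (hc.comp continuous_mul)
          ((hc.comp continuous_fst).mul (hc.comp continuous_snd)))
        (fun a b => by rw [← map_mul, hΨ', hΨ', hΨ', pairMap_mul_fst]) x y
    · change _ = (Ψ x).2 p * (Ψ y).2 p
      have hc := (continuous_snd_apply (k := k) (MQ := MQ) p).comp Ψ.continuous
      exact hj.induction_on₂ (p := fun x y => (Ψ (x * y)).2 p = (Ψ x).2 p * (Ψ y).2 p)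
        (isClosed_eq (hc.comp continuous_mul)
          ((hc.comp continuous_fst).mul (hc.comp continuous_snd)))
        (fun a b => by rw [← map_mul, hΨ', hΨ', hΨ', pairMap_mul_snd]) x y
  have hstar : ∀ x, Ψ (star x) = star (Ψ x) := by
    intro x
    refine Prod.ext (ZeroAtInftyContinuousMap.ext fun q => ?_)
      (ZeroAtInftyContinuousMap.ext fun p => ?_)
    · change _ = star ((Ψ x).1 q)
      have hc := (continuous_fst_apply (k := k) (R := R) q).comp Ψ.continuous
      exact hj.induction_on (p := fun x => (Ψ (star x)).1 q = star ((Ψ x).1 q)) x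
        (isClosed_eq (hc.comp continuous_star) hc.star)
        (fun a => by rw [← map_star, hΨ', hΨ', pairMap_star_fst])
    · change _ = star ((Ψ x).2 p)
      have hc := (continuous_snd_apply (k := k) (MQ := MQ) p).comp Ψ.continuous
      exact hj.induction_on (p := fun x => (Ψ (star x)).2 p = star ((Ψ x).2 p)) x
        (isClosed_eq (hc.comp continuous_star) hc.star)
        (fun a => by rw [← map_star, hΨ', hΨ', pairMap_star_snd])
  have hmem : ∀ x, Ψ x ∈ D.pairAlgebra := fun x => hrange'.subset ⟨x, rfl⟩
  let e : GroupoidCStar D.rel ≃ D.pairAlgebra := Equiv.ofBijective (fun x => ⟨Ψ x, hmem x⟩)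
    ⟨fun x y h => Ψ.injective (congrArg Subtype.val h), fun a => by
      obtain ⟨x, hx⟩ := hrange'.superset a.2
      exact ⟨x, Subtype.ext hx⟩⟩
  exact ⟨{ e with
    map_add' := fun x y => Subtype.ext (map_add Ψ x y)
    map_mul' := fun x y => Subtype.ext (hmul x y)
    map_smul' := fun c x => Subtype.ext (map_smul Ψ c x)
    map_star' := fun x => Subtype.ext (hstar x) }, hΨ'⟩

end Gluing

/-! ### Transport of `*`-homomorphisms along a `*`-isomorphism -/

section Hom

variable {A B C : Type*} [NonUnitalNonAssocSemiring A] [DistribMulAction ℂ A] [Star A]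
  [NonUnitalNonAssocSemiring B] [DistribMulAction ℂ B] [Star B]
  [NonUnitalNonAssocSemiring C] [DistribMulAction ℂ C] [Star C]

theorem exists_starAlgHom_comp_equiv (Φ : A ≃⋆ₐ[ℂ] B) (F : B →⋆ₙₐ[ℂ] C) :
    ∃ ρ : A →⋆ₙₐ[ℂ] C, ∀ a, ρ a = F (Φ a) :=
  ⟨{ toFun := fun a => F (Φ a)
     map_smul' := fun c a => by rw [map_smul, map_smul]; rfl
     map_zero' := by rw [map_zero, map_zero]
     map_add' := fun a b => by rw [map_add, map_add]
     map_mul' := fun a b => by rw [map_mul, map_mul]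
     map_star' := fun a => by rw [map_star, map_star] }, fun _ => rfl⟩

theorem exists_starAlgHom_lift_equiv (Φ : B ≃⋆ₐ[ℂ] C) (F : A →⋆ₙₐ[ℂ] C) :
    ∃ ι : A →⋆ₙₐ[ℂ] B, ∀ a, Φ (ι a) = F a := by
  refine ⟨{ toFun := fun a => Φ.symm (F a)
            map_smul' := fun c a => by rw [map_smul, map_smul]; rfl
            map_zero' := by rw [map_zero, map_zero]
            map_add' := fun a b => by rw [map_add, map_add]
            map_mul' := fun a b => by rw [map_mul, map_mul]
            map_star' := fun a => by rw [map_star, map_star] }, fun a => ?_⟩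
  exact Φ.apply_symm_apply (F a)

end Hom

/-! ## Matrix-valued functions on an open subset -/

section TensorMatrix

variable {X : Type*} [TopologicalSpace X] [T2Space X] {U : Set X} (hU : IsOpen U) {k : ℕ}

/-- The map `f ⊗ T ↦ f · T`, extended by zero, from `C₀(U) ⊗ M_k` to `C₀(X, M_k)`. -/
noncomputable def tensorToMatrix :
    C₀(U, ℂ) ⊗[ℂ] CStarMatrix (Fin k) (Fin k) ℂ →ₗ[ℂ] C₀(X, CStarMatrix (Fin k) (Fin k) ℂ) :=
  TensorProduct.lift <| LinearMap.mk₂ ℂ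
    (fun f T => .ofEntries fun i j => T i j • f.extendZero hU)
    (fun f f' T => by
      ext x : 1
      ext i j
      exact (congrArg (T i j * ·) (f.extendZero_add hU f' x)).trans (mul_add _ _ _))
    (fun c f T => by
      ext x : 1
      ext i j
      exact (congrArg (T i j * ·) (f.extendZero_smul hU c x)).trans (mul_left_comm _ _ _))
    (fun f T T' => by
      ext x : 1
      ext i j
      exact add_mul _ _ _)
    (fun c f T => by
      ext x : 1
      ext i j
      exact mul_assoc _ _ _)

theorem tensorToMatrix_tmul_apply (f : C₀(U, ℂ)) (T : CStarMatrix (Fin k) (Fin k) ℂ) (x : U) :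
    tensorToMatrix hU (f ⊗ₜ[ℂ] T) x = f x • T := by
  ext i j
  change T i j * f.extendZero hU x = f x * T i j
  rw [f.extendZero_apply hU x, mul_comm]

theorem tensorToMatrix_apply_of_notMem (t : C₀(U, ℂ) ⊗[ℂ] CStarMatrix (Fin k) (Fin k) ℂ) {x : X}
    (hx : x ∉ U) : tensorToMatrix hU t x = 0 := by
  induction t using TensorProduct.induction_on with
  | zero => rw [map_zero]; rfl
  | tmul f T =>
    ext i j
    change T i j * f.extendZero hU x = 0
    rw [f.extendZero_of_notMem hU hx, mul_zero]
  | add s t hs ht =>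
    rw [map_add]
    change tensorToMatrix hU s x + tensorToMatrix hU t x = 0
    rw [hs, ht, add_zero]

theorem tensorToMatrix_mul (s t : C₀(U, ℂ) ⊗[ℂ] CStarMatrix (Fin k) (Fin k) ℂ) :
    tensorToMatrix hU (s * t) = tensorToMatrix hU s * tensorToMatrix hU t := by
  induction s using TensorProduct.induction_on with
  | zero =>
    have h0 : 0 * t = 0 := by exact zero_mul t
    rw [h0, map_zero]
    exact (zero_mul (tensorToMatrix hU t)).symm
  | add s s' hs hs' =>
    have h0 : (s + s') * t = s * t + s' * t := NonUnitalNonAssocSemiring.right_distrib s s' t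
    rw [h0, map_add, map_add, hs, hs']
    exact (NonUnitalNonAssocSemiring.right_distrib (tensorToMatrix hU s) (tensorToMatrix hU s')
      (tensorToMatrix hU t)).symm
  | tmul f T =>
    induction t using TensorProduct.induction_on with
    | zero =>
      have h0 : (f ⊗ₜ[ℂ] T) * 0 = 0 := by exact mul_zero (f ⊗ₜ[ℂ] T)
      rw [h0, map_zero]
      exact (mul_zero (tensorToMatrix hU (f ⊗ₜ[ℂ] T))).symm
    | add t t' ht ht' =>
      have h0 : (f ⊗ₜ[ℂ] T) * (t + t') = (f ⊗ₜ[ℂ] T) * t + (f ⊗ₜ[ℂ] T) * t' :=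
        NonUnitalNonAssocSemiring.left_distrib (f ⊗ₜ[ℂ] T) t t'
      rw [h0, map_add, map_add, ht, ht']
      exact (NonUnitalNonAssocSemiring.left_distrib (tensorToMatrix hU (f ⊗ₜ[ℂ] T))
        (tensorToMatrix hU t) (tensorToMatrix hU t')).symm
    | tmul g S =>
      rw [Algebra.TensorProduct.tmul_mul_tmul]
      refine ZeroAtInftyContinuousMap.ext fun x => ?_
      change _ = tensorToMatrix hU (f ⊗ₜ[ℂ] T) x * tensorToMatrix hU (g ⊗ₜ[ℂ] S) x
      by_cases hx : x ∈ U
      · rw [tensorToMatrix_tmul_apply hU _ _ ⟨x, hx⟩, tensorToMatrix_tmul_apply hU _ _ ⟨x, hx⟩,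
          tensorToMatrix_tmul_apply hU _ _ ⟨x, hx⟩]
        exact (smul_mul_smul_comm _ _ _ _).symm
      · rw [tensorToMatrix_apply_of_notMem hU _ hx, tensorToMatrix_apply_of_notMem hU _ hx,
          zero_mul]

theorem tensorToMatrix_star (t : C₀(U, ℂ) ⊗[ℂ] CStarMatrix (Fin k) (Fin k) ℂ) :
    tensorToMatrix hU (star t) = star (tensorToMatrix hU t) := by
  induction t using TensorProduct.induction_on with
  | zero =>
    rw [star_zero, map_zero]
    exact (star_zero C₀(X, CStarMatrix (Fin k) (Fin k) ℂ)).symm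
  | add s t hs ht =>
    rw [star_add, map_add, map_add, hs, ht]
    exact (star_add (tensorToMatrix hU s) (tensorToMatrix hU t)).symm
  | tmul f T =>
    rw [TensorProduct.star_tmul]
    refine ZeroAtInftyContinuousMap.ext fun x => ?_
    change _ = star (tensorToMatrix hU (f ⊗ₜ[ℂ] T) x)
    by_cases hx : x ∈ U
    · rw [tensorToMatrix_tmul_apply hU _ _ ⟨x, hx⟩, tensorToMatrix_tmul_apply hU _ _ ⟨x, hx⟩,
        star_smul]
      rfl
    · rw [tensorToMatrix_apply_of_notMem hU _ hx, tensorToMatrix_apply_of_notMem hU _ hx,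
        star_zero]

/-- A matrix entry of an element of `A ⊗ M_k`. -/
noncomputable def tensorEntry {A : Type*} [AddCommGroup A] [Module ℂ A] (i j : Fin k) :
    A ⊗[ℂ] CStarMatrix (Fin k) (Fin k) ℂ →ₗ[ℂ] A :=
  TensorProduct.lift <| LinearMap.mk₂ ℂ (fun f T => T i j • f)
    (fun _ _ _ => smul_add _ _ _) (fun _ _ _ => smul_comm _ _ _)
    (fun _ _ _ => add_smul _ _ _) (fun _ _ _ => mul_smul _ _ _)

theorem tensorEntry_tmul {A : Type*} [AddCommGroup A] [Module ℂ A] (i j : Fin k) (f : A)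
    (T : CStarMatrix (Fin k) (Fin k) ℂ) : tensorEntry i j (f ⊗ₜ[ℂ] T) = T i j • f := rfl

/-- The matrix units. -/
def matrixUnit (i j : Fin k) : CStarMatrix (Fin k) (Fin k) ℂ :=
  CStarMatrix.ofMatrix (Matrix.single i j 1)

/-- The matrix units form a basis of `M_k`, so a tensor is determined by its entries. This gives
injectivity of `tensorToMatrix` and the form of the preimages, with no completion of the tensor
product. -/
theorem sum_tensorEntry_tmul {A : Type*} [AddCommGroup A] [Module ℂ A]
    (t : A ⊗[ℂ] CStarMatrix (Fin k) (Fin k) ℂ) :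
    ∑ i, ∑ j, tensorEntry i j t ⊗ₜ[ℂ] matrixUnit i j = t := by
  induction t using TensorProduct.induction_on with
  | zero => simp
  | add s t hs ht =>
    simp only [map_add, TensorProduct.add_tmul, Finset.sum_add_distrib]
    rw [hs, ht]
  | tmul f T =>
    simp only [tensorEntry_tmul, TensorProduct.smul_tmul, ← TensorProduct.tmul_sum]
    congr 1
    conv_rhs => rw [show T = CStarMatrix.ofMatrix T from rfl, Matrix.matrix_eq_sum_single T]
    change _ = ∑ i, ∑ j, CStarMatrix.ofMatrix (Matrix.single i j (T i j))
    refine Finset.sum_congr rfl fun i _ => Finset.sum_congr rfl fun j _ => ?_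
    change CStarMatrix.ofMatrix (T i j • Matrix.single i j (1 : ℂ)) = _
    rw [Matrix.smul_single, smul_eq_mul, mul_one]

theorem tensorToMatrix_apply_apply (t : C₀(U, ℂ) ⊗[ℂ] CStarMatrix (Fin k) (Fin k) ℂ) (x : U)
    (i j : Fin k) : tensorToMatrix hU t x i j = tensorEntry i j t x := by
  induction t using TensorProduct.induction_on with
  | zero => rw [map_zero, map_zero]; rfl
  | add s t hs ht =>
    rw [map_add, map_add]
    exact congrArg₂ (· + ·) hs ht
  | tmul f T =>
    rw [tensorToMatrix_tmul_apply, tensorEntry_tmul]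
    exact mul_comm _ _

theorem tensorToMatrix_injective : Function.Injective
    (tensorToMatrix hU : C₀(U, ℂ) ⊗[ℂ] CStarMatrix (Fin k) (Fin k) ℂ →ₗ[ℂ] _) := by
  intro s t h
  rw [← sum_tensorEntry_tmul s, ← sum_tensorEntry_tmul t]
  refine Finset.sum_congr rfl fun i _ => Finset.sum_congr rfl fun j _ => ?_
  congr 1
  ext x
  rw [← tensorToMatrix_apply_apply hU, ← tensorToMatrix_apply_apply hU, h]

theorem exists_tensorToMatrix_eq {g : C₀(X, CStarMatrix (Fin k) (Fin k) ℂ)}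
    (hg : ∀ x ∉ U, g x = 0) : ∃ t, tensorToMatrix hU t = g := by
  have h0 : ∀ i j, ∀ x ∉ U, g.entry i j x = 0 := fun i j x hx =>
    congrFun (congrFun (hg x hx) i) j
  refine ⟨∑ i, ∑ j, (g.entry i j).restrictOfEqZero (h0 i j) ⊗ₜ[ℂ] matrixUnit i j, ?_⟩
  refine ZeroAtInftyContinuousMap.ext fun x => ?_
  by_cases hx : x ∈ U
  · ext i j
    rw [tensorToMatrix_apply_apply hU _ ⟨x, hx⟩]
    simp only [map_sum, tensorEntry_tmul]
    have : ∀ a b, matrixUnit a b i j • (g.entry a b).restrictOfEqZero (h0 a b) =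
        if a = i then (if b = j then (g.entry i j).restrictOfEqZero (h0 i j) else 0) else 0 := by
      intro a b
      simp only [matrixUnit, CStarMatrix.ofMatrix_apply, Matrix.single_apply]
      by_cases ha : a = i <;> by_cases hb : b = j <;> simp [ha, hb]
    simp only [this, Finset.sum_ite_eq', Finset.mem_univ, if_true, Finset.sum_ite_irrel,
      Finset.sum_const_zero]
    rfl
  · rw [tensorToMatrix_apply_of_notMem hU _ hx, hg x hx]

end TensorMatrix

/-! ### The short exact sequence -/

namespace Gluing

variable {k : ℕ} {N : Type u} {MQ : Type v} {R : Type w}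
  [TopologicalSpace N] [TopologicalSpace MQ] [TopologicalSpace R] (D : Gluing k N MQ R)

/-- Extending `f` to all of `N` and restricting to the sheets gives the diagonal entries of `g`;
compatibility on `Σ` is automatic, since both components come from one function. -/
theorem exists_mem_pairAlgebra_fst_eq [T2Space N] [LocallyCompactSpace N] (f : C₀(MQ, ℂ)) :
    ∃ a ∈ D.pairAlgebra, a.1 = f := by
  obtain ⟨F, hF⟩ := f.exists_extension D.isClosedEmbedding_inclQ
  let Fi : Fin k → C₀(R, ℂ) := fun i =>
    ⟨⟨fun p => F (D.inclP (i, p)), F.continuous.comp (D.isClosedEmbedding_sheet i).continuous⟩,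
      (zero_at_infty F).comp (D.isClosedEmbedding_sheet i).tendsto_cocompact⟩
  refine ⟨(f, .ofEntries fun i j => if i = j then Fi i else 0), ?_, rfl⟩
  rw [mem_pairAlgebra_iff]
  intro p i j
  change (if i = j then Fi i else 0 : C₀(R, ℂ)) p = _
  split_ifs with hij
  · change F (D.inclP (i, (p : R))) = _
    rw [← D.glue i p, hF]
  · rfl

set_option synthInstance.maxHeartbeats 200000 in
/-- The ideal of `A` of functions supported over `R - Σ_R`. -/
theorem exists_tensorHom [T2Space N] :
    ∃ J : C₀(↥D.sigmaRᶜ, ℂ) ⊗[ℂ] CStarMatrix (Fin k) (Fin k) ℂ →⋆ₙₐ[ℂ] D.pairAlgebra,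
      Function.Injective J ∧ (∀ a : D.pairAlgebra, a.1.1 = 0 ↔ a ∈ range J) ∧
      ∀ (f : C₀(↥D.sigmaRᶜ, ℂ)) (T : CStarMatrix (Fin k) (Fin k) ℂ),
        (∀ p : ↥D.sigmaRᶜ, (J (f ⊗ₜ[ℂ] T)).1.2 (p : R) = f p • T) ∧
        (∀ p ∈ D.sigmaR, (J (f ⊗ₜ[ℂ] T)).1.2 p = 0) := by
  -- That `R` is Hausdorff and `Σ_R` closed is inherited from `N` through a sheet. For `k = 0` there
  -- is no sheet, but the ideal and the tensor product are both zero.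
  rcases k.eq_zero_or_pos with rfl | hk
  · have : Subsingleton (CStarMatrix (Fin 0) (Fin 0) ℂ) :=
      ⟨fun _ _ => CStarMatrix.ext fun i => i.elim0⟩
    have hs : Subsingleton (C₀(↥D.sigmaRᶜ, ℂ) ⊗[ℂ] CStarMatrix (Fin 0) (Fin 0) ℂ) :=
      ⟨fun s t => by rw [← sum_tensorEntry_tmul s, ← sum_tensorEntry_tmul t]; simp⟩
    let J : C₀(↥D.sigmaRᶜ, ℂ) ⊗[ℂ] CStarMatrix (Fin 0) (Fin 0) ℂ →⋆ₙₐ[ℂ] D.pairAlgebra :=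
      { toFun := fun _ => 0
        map_smul' := fun c _ => (smul_zero c).symm
        map_zero' := rfl
        map_add' := fun _ _ => (add_zero 0).symm
        map_mul' := fun _ _ => (mul_zero 0).symm
        map_star' := fun _ => (star_zero D.pairAlgebra).symm }
    refine ⟨J, fun _ _ _ => Subsingleton.elim _ _, fun a => ⟨fun ha => ⟨0, ?_⟩, ?_⟩,
      fun f T => ⟨fun p => Subsingleton.elim _ _, fun p hp => Subsingleton.elim _ _⟩⟩
    · exact Subtype.ext (Prod.ext ha.symm
        (ZeroAtInftyContinuousMap.ext fun p => Subsingleton.elim _ _))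
    · rintro ⟨t, rfl⟩
      rfl
  · let i₀ : Fin k := ⟨0, hk⟩
    have : T2Space R := (D.isClosedEmbedding_sheet i₀).isEmbedding.t2Space
    have hU := (D.isClosed_sigmaR_of i₀).isOpen_compl
    have hmem : ∀ t : C₀(↥D.sigmaRᶜ, ℂ) ⊗[ℂ] CStarMatrix (Fin k) (Fin k) ℂ,
        ((0, tensorToMatrix hU t) : C₀(MQ, ℂ) × _) ∈ D.pairAlgebra := by
      intro t
      rw [mem_pairAlgebra_iff]
      intro p i j
      have h0 := tensorToMatrix_apply_of_notMem hU t (x := p) (fun h => h p.2)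
      refine (congrFun (congrFun h0 i) j).trans ?_
      split_ifs <;> rfl
    let J : C₀(↥D.sigmaRᶜ, ℂ) ⊗[ℂ] CStarMatrix (Fin k) (Fin k) ℂ →⋆ₙₐ[ℂ] D.pairAlgebra :=
      { toFun := fun t => ⟨(0, tensorToMatrix hU t), hmem t⟩
        map_smul' := fun c t => Subtype.ext (Prod.ext (smul_zero c).symm (map_smul _ c t))
        map_zero' := Subtype.ext (Prod.ext rfl (map_zero _))
        map_add' := fun s t => Subtype.ext (Prod.ext (add_zero 0).symm (map_add _ s t))
        map_mul' := fun s t => Subtype.ext (Prod.ext (mul_zero 0).symm (tensorToMatrix_mul hU s t))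
        map_star' := fun t => Subtype.ext (Prod.ext (star_zero _).symm (tensorToMatrix_star hU t)) }
    refine ⟨J, fun s t h => tensorToMatrix_injective hU
      (congrArg (fun a : D.pairAlgebra => a.1.2) h), fun a => ⟨fun ha => ?_, ?_⟩,
      fun f T => ⟨fun p => tensorToMatrix_tmul_apply hU f T p,
        fun p hp => tensorToMatrix_apply_of_notMem hU _ fun h => h hp⟩⟩
    · obtain ⟨t, ht⟩ := exists_tensorToMatrix_eq hU (g := a.1.2) fun p hp => by
        ext i j
        have h := D.mem_pairAlgebra_iff.1 a.2 ⟨p, not_not.1 hp⟩ i j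
        rw [ha] at h
        refine h.trans ?_
        split_ifs <;> rfl
      exact ⟨t, Subtype.ext (Prod.ext ha.symm ht)⟩
    · rintro ⟨t, rfl⟩
      rfl

set_option synthInstance.maxHeartbeats 200000 in
/-- The first component of an element of `A`. -/
noncomputable def fstHom : D.pairAlgebra →⋆ₙₐ[ℂ] C₀(MQ, ℂ) where
  toFun a := a.1.1
  map_smul' _ _ := rfl
  map_zero' := rfl
  map_add' _ _ := rfl
  map_mul' _ _ := rfl
  map_star' _ := rfl

end Gluing

theorem mainTheorem5 {k : ℕ} {N : Type u} {MQ : Type v} {R : Type w}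
    [TopologicalSpace N] [TopologicalSpace MQ] [TopologicalSpace R]
    [T2Space N] [LocallyCompactSpace N] (D : Gluing k N MQ R) :
    ∃ Φ : GroupoidCStar D.rel ≃⋆ₐ[ℂ] D.pairAlgebra,
      (∀ h : ConvAlg D.rel,
        (∀ q : MQ, (Φ (toGroupoidCStar D.rel h)).1.1 q = h.kernel (D.inclQ q) (D.inclQ q)) ∧
        (∀ (p : R) (i j : Fin k), (Φ (toGroupoidCStar D.rel h)).1.2 p i j =
          h.kernel (D.inclP (i, p)) (D.inclP (j, p)))) ∧
      ∃ (ι : C₀(↥D.sigmaRᶜ, ℂ) ⊗[ℂ] CStarMatrix (Fin k) (Fin k) ℂ →⋆ₙₐ[ℂ] GroupoidCStar D.rel)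
        (ρ : GroupoidCStar D.rel →⋆ₙₐ[ℂ] C₀(MQ, ℂ)),
        Function.Injective ι ∧ Function.Exact ι ρ ∧ Function.Surjective ρ ∧
        (∀ a, ρ a = (Φ a).1.1) ∧
        (∀ (f : C₀(↥D.sigmaRᶜ, ℂ)) (T : CStarMatrix (Fin k) (Fin k) ℂ),
          (∀ p : ↥D.sigmaRᶜ, (Φ (ι (f ⊗ₜ[ℂ] T))).1.2 (p : R) = f p • T) ∧
          (∀ p ∈ D.sigmaR, (Φ (ι (f ⊗ₜ[ℂ] T))).1.2 p = 0)) := by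
  obtain ⟨Φ, hΦ⟩ := D.exists_starAlgEquiv
  obtain ⟨J, hJinj, hJrange, hJ⟩ := D.exists_tensorHom
  obtain ⟨ρ, hρ⟩ := exists_starAlgHom_comp_equiv Φ D.fstHom
  obtain ⟨ι, hι⟩ := exists_starAlgHom_lift_equiv Φ J
  refine ⟨Φ, fun h => ⟨fun q => ?_, fun p i j => ?_⟩, ι, ρ, fun s t h => ?_, fun a => ?_,
    fun f => ?_, hρ, fun f T => ?_⟩
  · rw [hΦ, D.pairMap_fst_apply]
  · rw [hΦ, D.pairMap_snd_apply_apply]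
  · exact hJinj (by rw [← hι, ← hι, h])
  · rw [hρ]
    -- Exactness holds in `A`, where the range of `J` is the kernel of the first projection, and `Φ`
    -- carries it over.
    refine (hJrange (Φ a)).trans ⟨?_, ?_⟩
    · rintro ⟨t, ht⟩
      exact ⟨t, Φ.injective ((hι t).trans ht)⟩
    · rintro ⟨t, rfl⟩
      exact ⟨t, (hι t).symm⟩
  · obtain ⟨a, ha, rfl⟩ := D.exists_mem_pairAlgebra_fst_eq f
    obtain ⟨b, hb⟩ := Φ.surjective ⟨a, ha⟩
    exact ⟨b, (hρ b).trans (congrArg D.fstHom hb)⟩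
  · rw [hι]
    exact hJ f T
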